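/- Let $n\ge 2$ and let $W\in\mathbb C[z_1,\dots,z_n]$ be a weighted homogeneous polynomial of weight $(w_1,\dots,w_n;h)$ (positive integers with $\gcd(w_1,\dots,w_n,h)=1$) which is non-degenerate: it contains no monomial $z_iz_j$ with $i\neq j$, and the origin is an isolated critical point of $W$. Let $G_W\subset(\mathbb C^*)^n$ be the group of diagonal symmetries of $W$, $N=|G_W|$, let $R_t(z)=(e^{2\pi i w_1t/h}z_1,\dots,e^{2\pi i w_nt/h}z_n)$ be the monodromy (Reeb) flow and $J=R_1\in G_W$. For $\delta>0$ let $L_W=W^{-1}(0)\cap S_\delta^{2n-1}$ be the link. For $g\in G_W$ and $l>0$ let $\Sigma_{g,l}=\{p\in L_W: gR_l(p)=p\}$ be the space of $g$-twisted Reeb orbits $\gamma(t)=R_t(p)$, $g\gamma(l)=\gamma(0)$, of period $l$. The index of such an orbit is taken with respect to the form $\Omega^{\otimes N}$, $\Omega=dz_1\wedge\cdots\wedge dz_n/dW$: choose a $C^1$ unitary frame $F_t$ of $(\ker dW)^{\oplus N}$ along $\gamma$ (for the metric of the symplectic form $\sum_k\frac{1}{\pi w_k}dx_k\wedge dy_k$)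 with $gF_l=F_0$, such that the loop $\Omega^{\otimes N}(F_t)$ in $\mathbb C^*$ has winding number $0$ and the path of symplectic matrices $\psi_t=F_t^{-1}\circ dR_t^{\oplus N}\circ F_0$ has only regular crossings; the index is $\frac1N$ times the Robbin–Salamon index $\frac12\operatorname{sign}\Gamma(\psi,0)+\sum_{0<t<l}\operatorname{sign}\Gamma(\psi,t)+\frac12\operatorname{sign}\Gamma(\psi,l)$, where $\Gamma(\psi,t)$ is the crossing form on $\ker(\psi_t-1)$. When all orbits of $\Sigma_{g,l}$ and all such frames give one and the same value, it is denoted $\mu_{RS}(\Sigma_{g,l})$. A cochain of degree $k$ on $\Sigma_{g,l}/G_W$ is given the degree $k+\star_{g,l}$, where $\star_{g,l}=(n-1)-\mu_{RS}(\Sigma_{g,l})-\frac12(\dim_{\mathbb R}\Sigma_{g,l}+1)$. The monodromy orbit $\Gamma_W$ is the fundamental class $1\in H^0(\Sigma_{J^{-1},1}/G_W;\mathbb Z)$ of the space $\Sigma_{J^{-1},1}=L_W$ of principal orbits, and $\mu_{RS}(\Gamma_W)=\mu_{RS}(\Sigma_{J^{-1},1})$. Then the index $\mu_{RS}(\Gamma_W)$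 is well defined (index values exist and all agree), and $$\deg(\Gamma_W)=-\mu_{RS}(\Gamma_W)=-\frac{2\big((\sum_{i=1}^n w_i)-h\big)}{h}.$$ In particular, $(\sum_{i=1}^n w_i)-h\ge 0$ if and only if $\mu_{RS}(\Gamma_W)\ge 0$. -/

import Mathlib

open scoped BigOperators ComplexConjugate Topology

noncomputable section

namespace MonodromyOrbit

/-! ### The Robbin–Salamon index of a path of symplectic maps -/

section RobbinSalamon

variable {ι : Type*} [Fintype ι]

/-- The standard symplectic form `ω₀(u, v) = Im ∑ conj (u_a) v_a = ∑ dx_a ∧ dy_a (u, v)` of the real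
vector space `ℂ^ι`.  It satisfies `ω₀(u, i u) = ‖u‖² ≥ 0`. -/
def stdSymp (ι : Type*) [Fintype ι] : (ι → ℂ) →ₗ[ℝ] (ι → ℂ) →ₗ[ℝ] ℝ :=
  LinearMap.mk₂ ℝ (fun u v => (∑ a, conj (u a) * v a).im)
    (by intro u u' v; simp [add_mul, Finset.sum_add_distrib])
    (by
      intro c u v
      have : ∀ a, conj ((c • u) a) * v a = (c : ℂ) * (conj (u a) * v a) := by
        intro a; simp [mul_assoc]
      simp only [this, ← Finset.mul_sum, Complex.im_ofReal_mul, smul_eq_mul])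
    (by intro u v v'; simp [mul_add, Finset.sum_add_distrib])
    (by
      intro c u v
      have : ∀ a, conj (u a) * (c • v) a = (c : ℂ) * (conj (u a) * v a) := by
        intro a; simp [mul_left_comm]
      simp only [this, ← Finset.mul_sum, Complex.im_ofReal_mul, smul_eq_mul])

/-- `ker (ψ_t - 1)`; the time `t` is a crossing if this space is nonzero. -/
def crossingSpace (ψ : ℝ → ((ι → ℂ) →L[ℝ] (ι → ℂ))) (t : ℝ) : Submodule ℝ (ι → ℂ) :=
  LinearMap.ker ((ψ t : (ι → ℂ) →ₗ[ℝ] (ι → ℂ)) - LinearMap.id)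

/-- The crossing form `v ↦ ω₀(v, ψ'_t v)` on `ker (ψ_t - 1)`.  For `ψ' = J₀ S ψ`, with `S` symmetric,
it is `v ↦ ⟨v, S_t v⟩`. -/
def crossingForm (ψ : ℝ → ((ι → ℂ) →L[ℝ] (ι → ℂ))) (t : ℝ) :
    QuadraticForm ℝ (crossingSpace ψ t) :=
  LinearMap.BilinMap.toQuadraticMap
    (((stdSymp ι).compl₂ (deriv ψ t).toLinearMap).domRestrict₁₂
      (crossingSpace ψ t) (crossingSpace ψ t))

/-- The signature of the crossing form at time `t` (it is `0` if `t` is not a crossing). -/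
def crossingSign (ψ : ℝ → ((ι → ℂ) →L[ℝ] (ι → ℂ))) (t : ℝ) : ℤ :=
  (sigPos (crossingForm ψ t) : ℤ) - (sigNeg (crossingForm ψ t) : ℤ)

/-- All crossings of the path `ψ` in `[0, l]` are regular: the crossing forms are nondegenerate. -/
def RegularCrossings (ψ : ℝ → ((ι → ℂ) →L[ℝ] (ι → ℂ))) (l : ℝ) : Prop :=
  ∀ t ∈ Set.Icc 0 l, (QuadraticMap.polarBilin (crossingForm ψ t)).SeparatingLeft

/-- The Robbin–Salamon index of a `C¹` path `ψ : [0, l] → Sp(ℂ^ι, ω₀)` with regular crossings: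
`½ sign Γ(ψ, 0) + ∑_{0 < t < l} sign Γ(ψ, t) + ½ sign Γ(ψ, l)`. -/
def robbinSalamon (ψ : ℝ → ((ι → ℂ) →L[ℝ] (ι → ℂ))) (l : ℝ) : ℝ :=
  (crossingSign ψ 0 : ℝ) / 2 + (∑ᶠ t ∈ Set.Ioo 0 l, (crossingSign ψ t : ℝ)) +
    (crossingSign ψ l : ℝ) / 2

end RobbinSalamon

/-! ### Weighted homogeneous polynomials and diagonal symmetries

The number of variables is written `m + 1`, so that `m` is the complex dimension of the Milnor fiber. -/

variable {m : ℕ}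

/-- `W` is a non-degenerate weighted homogeneous polynomial of weight `(w; h)`. -/
structure IsNondegenerate (W : MvPolynomial (Fin (m + 1)) ℂ) (w : Fin (m + 1) → ℕ) (h : ℕ) :
    Prop where
  w_pos : ∀ i, 0 < w i
  h_pos : 0 < h
  gcd_eq_one : Nat.gcd (Finset.univ.gcd w) h = 1
  homogeneous : MvPolynomial.IsWeightedHomogeneous w W h
  /-- `W` contains no monomial `x_i x_j` with `i ≠ j`. -/
  no_mixed_quadratic : ∀ i j, i ≠ j →
    MvPolynomial.coeff (Finsupp.single i 1 + Finsupp.single j 1) W = 0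
  /-- The origin is a critical point of `W`. -/
  critical : ∀ i, MvPolynomial.eval 0 (MvPolynomial.pderiv i W) = 0
  /-- The origin is isolated among the critical points of `W`. -/
  isolated : ∀ᶠ z in 𝓝[≠] (0 : Fin (m + 1) → ℂ),
    ∃ i, MvPolynomial.eval z (MvPolynomial.pderiv i W) ≠ 0

/-- The maximal diagonal symmetry group `G_W`. The action `g • x` is the coordinatewise one. -/
def diagonalSymmetry (W : MvPolynomial (Fin (m + 1)) ℂ) : Subgroup (Fin (m + 1) → ℂˣ) where
  carrier := {g | ∀ x : Fin (m + 1) → ℂ, MvPolynomial.eval (g • x) W = MvPolynomial.eval x W}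
  one_mem' := by intro x; simp
  mul_mem' := by
    intro a b ha hb x
    rw [mul_smul, ha, hb]
  inv_mem' := by
    intro a ha x
    rw [← ha (a⁻¹ • x), smul_inv_smul]

/-- The monodromy (Reeb) flow at time `t`, as an element of the torus:
`(exp (2πi w_1 t / h), …)`.  It acts linearly on `ℂ^{m+1}`, so it is its own linearization. -/
def flow (w : Fin (m + 1) → ℕ) (h : ℕ) (t : ℝ) : Fin (m + 1) → ℂˣ :=
  fun i => Units.mk0 (Complex.exp (2 * Real.pi * Complex.I * ((w i : ℂ) / (h : ℂ)) * (t : ℂ)))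
    (Complex.exp_ne_zero _)

theorem flow_one_mem {W : MvPolynomial (Fin (m + 1)) ℂ} {w : Fin (m + 1) → ℕ} {h : ℕ}
    (hW : IsNondegenerate W w h) : flow w h 1 ∈ diagonalSymmetry W := by
  intro x
  rw [MvPolynomial.eval_eq', MvPolynomial.eval_eq']
  refine Finset.sum_congr rfl fun d hd => ?_
  have hwd := hW.homogeneous (MvPolynomial.mem_support_iff.mp hd)
  have hh : (h : ℂ) ≠ 0 := by exact_mod_cast hW.h_pos.ne'
  have hsum : ∑ i, (d i : ℂ) * (w i : ℂ) = h := by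
    rw [Finsupp.weight_apply, Finsupp.sum_fintype _ _ (by simp)] at hwd
    exact_mod_cast hwd
  have h1 : ∏ i, ((flow w h 1 i : ℂˣ) : ℂ) ^ d i = 1 := by
    have : ∀ i, ((flow w h 1 i : ℂˣ) : ℂ) ^ d i
        = Complex.exp ((2 * Real.pi * Complex.I / h) * ((d i : ℂ) * (w i : ℂ))) := by
      intro i
      simp only [flow, Units.val_mk0, ← Complex.exp_nat_mul]
      congr 1
      push_cast
      field_simp
    simp only [this]
    rw [← Complex.exp_sum, ← Finset.mul_sum, hsum, div_mul_cancel₀ _ hh, Complex.exp_two_pi_mul_I]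
  have h2 : ∏ i, (flow w h 1 • x) i ^ d i = ∏ i, x i ^ d i := by
    have : ∀ i, (flow w h 1 • x) i ^ d i = ((flow w h 1 i : ℂˣ) : ℂ) ^ d i * x i ^ d i := by
      intro i
      rw [← mul_pow]
      rfl
    simp only [this, Finset.prod_mul_distrib, h1, one_mul]
  rw [h2]

/-- The monodromy element `J ∈ G_W`, the time-one map of the flow. -/
def monodromyElement {W : MvPolynomial (Fin (m + 1)) ℂ} {w : Fin (m + 1) → ℕ} {h : ℕ}
    (hW : IsNondegenerate W w h) : diagonalSymmetry W :=
  ⟨flow w h 1, flow_one_mem hW⟩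

/-! ### The link and the components of twisted Reeb orbits -/

/-- The differential `dW_z (v)`. -/
def dW (W : MvPolynomial (Fin (m + 1)) ℂ) (z v : Fin (m + 1) → ℂ) : ℂ :=
  ∑ i, MvPolynomial.eval z (MvPolynomial.pderiv i W) * v i

/-- The link `W⁻¹(0) ∩ S_δ^{2m+1}`. -/
def link (W : MvPolynomial (Fin (m + 1)) ℂ) (δ : ℝ) : Set (Fin (m + 1) → ℂ) :=
  {z | MvPolynomial.eval z W = 0 ∧ ∑ i, ‖z i‖ ^ 2 = δ ^ 2}

/-- The space `Σ_{g,l}` of `g`-twisted Reeb orbits `γ(t) = R_t p`, `0 ≤ t ≤ l`, `g γ(l) = γ(0)`,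
in the link; an orbit is identified with its initial point `p`. -/
def twistedOrbits (W : MvPolynomial (Fin (m + 1)) ℂ) (w : Fin (m + 1) → ℕ) (h : ℕ) (δ : ℝ)
    (g : diagonalSymmetry W) (l : ℝ) : Set (Fin (m + 1) → ℂ) :=
  {p | p ∈ link W δ ∧ (g : Fin (m + 1) → ℂˣ) • (flow w h l • p) = p}

/-- The tangent space at `p` of `Σ_{g,l} = Fix(g R_l) ∩ W⁻¹(0) ∩ S_δ`, a transverse intersection
of the linear space `Fix(g R_l)` with the sphere and with the regular part of `W⁻¹(0)`. -/
def tangentSpace (W : MvPolynomial (Fin (m + 1)) ℂ) (w : Fin (m + 1) → ℕ) (h : ℕ)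
    (g : diagonalSymmetry W) (l : ℝ) (p : Fin (m + 1) → ℂ) : Submodule ℝ (Fin (m + 1) → ℂ) where
  carrier := {v | (g : Fin (m + 1) → ℂˣ) • (flow w h l • v) = v ∧ dW W p v = 0 ∧
    (∑ i, conj (p i) * v i).re = 0}
  zero_mem' := by simp [dW]
  add_mem' := by
    rintro u v ⟨hu, hu', hu''⟩ ⟨hv, hv', hv''⟩
    refine ⟨by rw [smul_add, smul_add, hu, hv], ?_, ?_⟩
    · simp only [dW, Pi.add_apply, mul_add, Finset.sum_add_distrib] at *
      rw [hu', hv', add_zero]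
    · simp only [Pi.add_apply, mul_add, Finset.sum_add_distrib, Complex.add_re] at *
      rw [hu'', hv'', add_zero]
  smul_mem' := by
    rintro c v ⟨hv, hv', hv''⟩
    refine ⟨?_, ?_, ?_⟩
    · conv_rhs => rw [← hv]
      ext i
      simp [Units.smul_def, mul_left_comm]
    · have : ∀ i, MvPolynomial.eval p (MvPolynomial.pderiv i W) * (c • v) i
          = (c : ℂ) * (MvPolynomial.eval p (MvPolynomial.pderiv i W) * v i) := by
        intro i; simp [mul_left_comm]
      simp only [dW, this, ← Finset.mul_sum] at *
      rw [hv', mul_zero]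
    · have : ∀ i, conj (p i) * (c • v) i = (c : ℂ) * (conj (p i) * v i) := by
        intro i; simp [mul_left_comm]
      simp only [this, ← Finset.mul_sum, Complex.re_ofReal_mul] at *
      rw [hv'', mul_zero]

/-- The real dimension of `Σ_{g,l}`. -/
def orbitsDim (W : MvPolynomial (Fin (m + 1)) ℂ) (w : Fin (m + 1) → ℕ) (h : ℕ) (δ : ℝ)
    (g : diagonalSymmetry W) (l : ℝ) : ℕ :=
  sSup {d | ∃ p ∈ twistedOrbits W w h δ g l, d = Module.finrank ℝ (tangentSpace W w h g l p)}

/-! ### Fractional Robbin–Salamon indices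

The linearized Reeb flow acts on `T = ker dW` along an orbit.  Write `N = |G_W|`.  The form `Ω^{⊗N}`,
where `Ω = dz_1 ∧ … ∧ dz_{m+1} / dW`, descends to the quotient by `G_W`; it is a nowhere zero section
of the dual of the top exterior power of `T^{⊕N}`.  The index of an orbit with respect to `Ω^{⊗N}` is
the index of the `N`-fold direct sum of the linearized flow in a unitary frame of `T^{⊕N}` along
the orbifold loop on which `Ω^{⊗N}` is homotopic to a constant. -/

/-- The Hermitian metric on `(ℂ^{m+1})^{⊕N}` belonging to the symplectic form
`∑_k (π w_k)⁻¹ dx_k ∧ dy_k = d(∑_k (i / 4π w_k) (z_k dz̄_k - z̄_k dz_k))`. -/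
def herm (w : Fin (m + 1) → ℕ) {N : ℕ} (u v : Fin N → Fin (m + 1) → ℂ) : ℂ :=
  ∑ c, ∑ k, ((Real.pi * (w k : ℝ))⁻¹ : ℝ) * (conj (u c k) * v c k)

/-- A vector with `dW_z = 1` (at a regular point `z`): the normalized Hermitian gradient. -/
def normalVector (W : MvPolynomial (Fin (m + 1)) ℂ) (z : Fin (m + 1) → ℂ) : Fin (m + 1) → ℂ :=
  fun i => conj (MvPolynomial.eval z (MvPolynomial.pderiv i W)) /
    ((∑ k, ‖MvPolynomial.eval z (MvPolynomial.pderiv k W)‖ ^ 2 : ℝ) : ℂ)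

/-- `Ω^{⊗N}` evaluated on a frame `F` of `T^{⊕N}` at `z`.  Here
`Ω(v_1, …, v_m) = det (ν, v_1, …, v_m)` for any `ν` with `dW_z(ν) = 1`; for `T^{⊕N}` one completes
the frame by one such vector in each of the `N` copies. -/
def volumeForm (W : MvPolynomial (Fin (m + 1)) ℂ) {N : ℕ} (z : Fin (m + 1) → ℂ)
    (F : Fin N × Fin m → Fin N → Fin (m + 1) → ℂ) : ℂ :=
  Matrix.det (Matrix.of fun (r s : Fin N × Fin (m + 1)) =>
    (Fin.cases (if r.1 = s.1 then normalVector W z r.2 else 0)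
      (fun j => F (s.1, j) r.1 r.2) s.2 : ℂ))

/-- `F` is a unitary frame of `T^{⊕N}`, `N = |G_W|`, along the `g`-twisted orbit of period `l`
through `p`, compatible with the twist and adapted to `Ω^{⊗N}`. -/
structure IsAdaptedFrame (W : MvPolynomial (Fin (m + 1)) ℂ) (w : Fin (m + 1) → ℕ) (h : ℕ)
    (g : diagonalSymmetry W) (l : ℝ) (p : Fin (m + 1) → ℂ)
    (F : ℝ → Fin (Nat.card (diagonalSymmetry W)) × Fin m →
      Fin (Nat.card (diagonalSymmetry W)) → Fin (m + 1) → ℂ) : Prop where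
  contDiff : ContDiff ℝ 1 F
  tangent : ∀ t ∈ Set.Icc 0 l, ∀ a c, dW W (flow w h t • p) (F t a c) = 0
  orthonormal : ∀ t ∈ Set.Icc 0 l, ∀ a b, herm w (F t a) (F t b) = if a = b then 1 else 0
  twist : ∀ a c, (g : Fin (m + 1) → ℂˣ) • F l a c = F 0 a c
  /-- The loop `t ↦ Ω^{⊗N}(F_t)` in `ℂ \ {0}` has winding number zero. -/
  adapted : ∃ L : ℝ → ℂ, ContinuousOn L (Set.Icc 0 l) ∧
    (∀ t ∈ Set.Icc 0 l, Complex.exp (L t) = volumeForm W (flow w h t • p) (F t)) ∧ L l = L 0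

/-- The `N`-fold direct sum of the linearized Reeb flow `T_p → T_{R_t p}` in the unitary frame `F`,
that is `F_t⁻¹ ∘ dR_t ∘ F_0`. -/
def flowMatrix (w : Fin (m + 1) → ℕ) (h : ℕ) {N : ℕ}
    (F : ℝ → Fin N × Fin m → Fin N → Fin (m + 1) → ℂ) (t : ℝ) :
    Matrix (Fin N × Fin m) (Fin N × Fin m) ℂ :=
  Matrix.of fun a b => herm w (F t a) (fun c => flow w h t • F 0 b c)

/-- The same path, in the group of real linear symplectic maps. -/
def flowPath (w : Fin (m + 1) → ℕ) (h : ℕ) {N : ℕ}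
    (F : ℝ → Fin N × Fin m → Fin N → Fin (m + 1) → ℂ) (t : ℝ) :
    (Fin N × Fin m → ℂ) →L[ℝ] (Fin N × Fin m → ℂ) :=
  LinearMap.toContinuousLinearMap ((flowMatrix w h F t).mulVecLin.restrictScalars ℝ)

/-- The values `(1/N) μ_RS^{Ω^{⊗N}}` of the index over all orbits of `Σ_{g,l}` and over all adapted
frames in which the linearized flow has regular crossings. -/
def indexValues (W : MvPolynomial (Fin (m + 1)) ℂ) (w : Fin (m + 1) → ℕ) (h : ℕ) (δ : ℝ)
    (g : diagonalSymmetry W) (l : ℝ) : Set ℝ :=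
  {μ | ∃ p ∈ twistedOrbits W w h δ g l, ∃ F, IsAdaptedFrame W w h g l p F ∧
    RegularCrossings (flowPath w h F) l ∧
    μ = robbinSalamon (flowPath w h F) l / (Nat.card (diagonalSymmetry W) : ℝ)}

/-- The Robbin–Salamon index `μ_RS(Σ_{g,l})`: the unique index value. -/
def componentIndex (W : MvPolynomial (Fin (m + 1)) ℂ) (w : Fin (m + 1) → ℕ) (h : ℕ) (δ : ℝ)
    (g : diagonalSymmetry W) (l : ℝ) : ℝ :=
  Classical.epsilon fun μ : ℝ => indexValues W w h δ g l = {μ}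

/-- The degree shifting number
`⋆_{g,l} = (n - 1) - μ_RS(Σ_{g,l}) - (dim_ℝ Σ_{g,l} + 1) / 2`, where `n - 1 = m`. -/
def degreeShift (W : MvPolynomial (Fin (m + 1)) ℂ) (w : Fin (m + 1) → ℕ) (h : ℕ) (δ : ℝ)
    (g : diagonalSymmetry W) (l : ℝ) : ℝ :=
  (m : ℝ) - componentIndex W w h δ g l - ((orbitsDim W w h δ g l : ℝ) + 1) / 2

/-! ### Cochains of the Morse–Bott components and the monodromy orbit -/

/-- The orbit space `Σ_{g,l} / G_W`. -/
def OrbitSpace (W : MvPolynomial (Fin (m + 1)) ℂ) (w : Fin (m + 1) → ℕ) (h : ℕ) (δ : ℝ)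
    (g : diagonalSymmetry W) (l : ℝ) : Type :=
  Quotient ((MulAction.orbitRel (diagonalSymmetry W) (Fin (m + 1) → ℂ)).comap
    (Subtype.val : twistedOrbits W w h δ g l → (Fin (m + 1) → ℂ)))

instance (W : MvPolynomial (Fin (m + 1)) ℂ) (w : Fin (m + 1) → ℕ) (h : ℕ) (δ : ℝ)
    (g : diagonalSymmetry W) (l : ℝ) : TopologicalSpace (OrbitSpace W w h δ g l) :=
  inferInstanceAs (TopologicalSpace (Quotient _))

/-- A homogeneous element of `⨁_{g,l} C^{• - ⋆_{g,l}}(Σ_{g,l} / G_W; ℤ)`: a (singular) integral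
cochain on one of the spaces of nonconstant twisted Reeb orbits modulo `G_W`. -/
structure OrbitCochain (W : MvPolynomial (Fin (m + 1)) ℂ) (w : Fin (m + 1) → ℕ) (h : ℕ)
    (δ : ℝ) where
  g : diagonalSymmetry W
  l : ℝ
  l_pos : 0 < l
  k : ℕ
  cochain : C(stdSimplex ℝ (Fin (k + 1)), OrbitSpace W w h δ g l) → ℤ

namespace OrbitCochain

variable {W : MvPolynomial (Fin (m + 1)) ℂ} {w : Fin (m + 1) → ℕ} {h : ℕ} {δ : ℝ}

/-- The degree of a cochain in `C^{• - ⋆_{g,l}}(Σ_{g,l} / G_W)`. -/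
def deg (c : OrbitCochain W w h δ) : ℝ := (c.k : ℝ) + degreeShift W w h δ c.g c.l

/-- The index values of the orbits that carry the cochain. -/
def indexValues (c : OrbitCochain W w h δ) : Set ℝ :=
  MonodromyOrbit.indexValues W w h δ c.g c.l

/-- The Robbin–Salamon index of the orbits that carry the cochain. -/
def muRS (c : OrbitCochain W w h δ) : ℝ := componentIndex W w h δ c.g c.l

end OrbitCochain

/-- The monodromy orbit `Γ_W`: the fundamental class `1 ∈ H^0(Σ_{J⁻¹,1} / G_W; ℤ)` of the space
`Σ_{J⁻¹,1} = L_W` of principal orbits, represented by the `0`-cochain with constant value `1`. -/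
def monodromyOrbit {W : MvPolynomial (Fin (m + 1)) ℂ} {w : Fin (m + 1) → ℕ} {h : ℕ}
    (hW : IsNondegenerate W w h) (δ : ℝ) : OrbitCochain W w h δ where
  g := (monodromyElement hW)⁻¹
  l := 1
  l_pos := one_pos
  k := 0
  cochain := fun _ => 1

end MonodromyOrbit

end

/-! In a unitary frame of `T^{⊕N}` the linearized flow along a principal orbit is a path of unitary
matrices `ψ_t`. Since `g = J⁻¹` and `J = R_1`, the twist condition says `F_1 = R_1 F_0`, so `ψ` is a
loop based at `1`.

The index of a unitary loop is twice the winding number of its determinant (`robbinSalamon_loop`).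
To see this one follows the argument of `det (1 - ψ)`. Invertible matrices with nonnegative
Hermitian part form a set that is star-shaped about `1`, so they carry a continuous argument
`argDet` of the determinant, and `1 - ψ` is of this kind off the crossings. If `det ψ = e^{iθ}`, the
identity `1 - ψ = -ψ (1 - ψ)ᴴ` keeps `2 argDet (1 - ψ) - θ` in one coset of `2πℤ`. At a regular
crossing this quantity drops by `π` times the signature of the crossing form, symmetrically about a
central value (`exists_tendsto_argDet`). Where `ψ = 1` that central value is `-θ`. Adding up the
drops, half of one at each end, gives the claim (`sum_of_jumps`).

The determinant comes from homogeneity: the flow multiplies `dz_1 ∧ … ∧ dz_{m+1}` by `exp (2πi t ∑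
w_i / h)` and `dW` by `exp (2πi t)`, hence `Ω^{⊗N}` by `exp (2πi N (∑ w_i / h - 1) t)`
(`volumeForm_flow`). As `Ω^{⊗N}(F_t)` does not wind, `det ψ` winds `N (∑ w_i / h - 1)` times,
whatever the orbit and the frame.

The set of index values must also be nonempty. The link has points, and a frame carried by the flow,
corrected by phases of nonzero integer speeds, is adapted with regular crossings
(`exists_adaptedFrame`); this uses that `G_W` is finite with at least two elements. Finally the link
has dimension `2m - 1`, which makes the degree shift equal to `-μ_RS`. -/

noncomputable section

namespace MonodromyOrbit

open scoped Matrix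

/-! ### A continuous argument of the determinant on accretive matrices -/

section Accretive

variable {k : Type*} [Fintype k] [DecidableEq k]

/-- The invertible complex matrices with positive semidefinite Hermitian part. -/
def accretive (k : Type*) [Fintype k] [DecidableEq k] : Set (Matrix k k ℂ) :=
  {M | (∀ v : k → ℂ, 0 ≤ (star v ⬝ᵥ M *ᵥ v).re) ∧ M.det ≠ 0}

omit [DecidableEq k] in
theorem dotProduct_star_self_re_pos {v : k → ℂ} (hv : v ≠ 0) : 0 < (star v ⬝ᵥ v).re := by
  obtain ⟨i, hi⟩ := Function.ne_iff.mp hv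
  have h : ∀ j, (star (v j) * v j).re = ‖v j‖ ^ 2 := by
    intro j
    rw [Complex.star_def, Complex.conj_mul', ← Complex.ofReal_pow, Complex.ofReal_re]
  simp only [dotProduct, Pi.star_apply, Complex.re_sum, h]
  refine Finset.sum_pos' (fun j _ => by positivity) ⟨i, Finset.mem_univ _, ?_⟩
  have : v i ≠ 0 := hi
  positivity

/-- For `τ < 1` the multiple of `1` makes the Hermitian part positive definite, so there is no
kernel. This is the star-shapedness about `1`. -/
theorem one_add_smul_mem_accretive {M : Matrix k k ℂ} (hM : M ∈ accretive k) {τ : ℝ}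
    (h0 : 0 ≤ τ) (h1 : τ ≤ 1) : (1 - τ) • (1 : Matrix k k ℂ) + τ • M ∈ accretive k := by
  have key : ∀ v : k → ℂ, (star v ⬝ᵥ ((1 - τ) • (1 : Matrix k k ℂ) + τ • M) *ᵥ v).re
      = (1 - τ) * (star v ⬝ᵥ v).re + τ * (star v ⬝ᵥ M *ᵥ v).re := by
    intro v
    simp [Matrix.add_mulVec, Matrix.smul_mulVec, dotProduct_add, dotProduct_smul]
  have hpos : ∀ v : k → ℂ, 0 ≤ (star v ⬝ᵥ v).re := by
    intro v
    by_cases hv : v = 0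
    · simp [hv]
    · exact (dotProduct_star_self_re_pos hv).le
  refine ⟨fun v => ?_, ?_⟩
  · rw [key]
    have := hM.1 v
    have := hpos v
    have : 0 ≤ 1 - τ := by linarith
    positivity
  · rcases eq_or_lt_of_le h1 with rfl | h1
    · simpa using hM.2
    · intro hdet
      obtain ⟨v, hv, hv'⟩ := Matrix.exists_mulVec_eq_zero_iff.mpr hdet
      have h := key v
      rw [hv'] at h
      have h2 := hM.1 v
      have h3 := dotProduct_star_self_re_pos hv
      have h4 : 0 < 1 - τ := by linarith
      have : 0 < (1 - τ) * (star v ⬝ᵥ v).re := by positivity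
      have : 0 ≤ τ * (star v ⬝ᵥ M *ᵥ v).re := by positivity
      simp at h
      linarith

theorem one_mem_accretive : (1 : Matrix k k ℂ) ∈ accretive k := by
  refine ⟨fun v => ?_, by simp⟩
  rw [Matrix.one_mulVec]
  by_cases hv : v = 0
  · simp [hv]
  · exact (dotProduct_star_self_re_pos hv).le

/-- `x` is an argument of `z`. -/
def IsArg (z : ℂ) (x : ℝ) : Prop := z = ‖z‖ * Complex.exp (x * Complex.I)

/-- Contracting to `1` along segments, the determinant is a homotopy in `ℂ \ {0}` from the constant
`1`. It lifts through the covering `exp`, and the imaginary part of the lift at time one is the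
argument. -/
theorem exists_continuous_arg_det : ∃ α : Matrix k k ℂ → ℝ, ContinuousOn α (accretive k) ∧
    α 1 = 0 ∧ ∀ M ∈ accretive k, IsArg M.det (α M) := by
  let H : C(unitInterval × accretive k, {z : ℂ // z ≠ 0}) :=
    ⟨fun q => ⟨((1 - (q.1 : ℝ)) • (1 : Matrix k k ℂ) + (q.1 : ℝ) • (q.2 : Matrix k k ℂ)).det,
      (one_add_smul_mem_accretive q.2.2 q.1.2.1 q.1.2.2).2⟩, by
      refine Continuous.subtype_mk ?_ _
      refine Continuous.matrix_det ?_
      fun_prop⟩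
  have H0 : ∀ a, H (0, a) = ⟨Complex.exp ((ContinuousMap.const (accretive k) (0 : ℂ)) a),
      Complex.exp_ne_zero _⟩ := by
    intro a
    apply Subtype.ext
    simp [H]
  let L := Complex.isCoveringMap_exp.liftHomotopy H (ContinuousMap.const (accretive k) 0) H0
  have hL : ∀ q, Complex.exp (L q) = (H q : ℂ) := fun q =>
    congrArg Subtype.val (congrFun (Complex.isCoveringMap_exp.liftHomotopy_lifts H _ H0) q)
  have hL0 : ∀ a, L (0, a) = 0 := fun a =>
    Complex.isCoveringMap_exp.liftHomotopy_zero H _ H0 a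
  -- The segment from `1` to `1` is constant, so its lift stays at `0`; this normalizes the argument
  -- at `1`.
  have hL1 : ∀ t, L (t, ⟨1, one_mem_accretive⟩) = 0 := by
    have := Complex.isCoveringMap_exp.eq_of_comp_eq (A := unitInterval)
      (g₁ := fun t => L (t, ⟨1, one_mem_accretive⟩)) (g₂ := fun _ => 0)
      (by fun_prop) (by fun_prop) ?_ 0 (hL0 _)
    · exact fun t => congrFun this t
    · funext t
      apply Subtype.ext
      simp only [Function.comp, hL]
      simp [H, ← add_smul]
  refine ⟨fun M => by
    classical exact if hM : M ∈ accretive k then (L (1, ⟨M, hM⟩)).im else 0, ?_, ?_, ?_⟩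
  · rw [continuousOn_iff_continuous_domRestrict]
    have : (accretive k).domRestrict (fun M => by
        classical exact if hM : M ∈ accretive k then (L (1, ⟨M, hM⟩)).im else 0)
        = fun M => (L (1, M)).im := by
      funext M
      simp
    rw [this]
    fun_prop
  · simp [one_mem_accretive, hL1]
  · intro M hM
    have h := hL (1, ⟨M, hM⟩)
    have h' : (H (1, ⟨M, hM⟩) : ℂ) = M.det := by simp [H]
    rw [h'] at h
    simp only [hM, dite_true, IsArg]
    rw [← h, Complex.norm_exp, Complex.ofReal_exp, ← Complex.exp_add, Complex.re_add_im]

/-- The argument of the determinant on accretive matrices, continuous and zero at `1`. -/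
def argDet (M : Matrix k k ℂ) : ℝ := exists_continuous_arg_det.choose M

theorem continuousOn_argDet : ContinuousOn argDet (accretive k) :=
  exists_continuous_arg_det.choose_spec.1

theorem argDet_one : argDet (1 : Matrix k k ℂ) = 0 := exists_continuous_arg_det.choose_spec.2.1

theorem isArg_argDet {M : Matrix k k ℂ} (hM : M ∈ accretive k) : IsArg M.det (argDet M) :=
  exists_continuous_arg_det.choose_spec.2.2 M hM

/-! ### Arguments of complex numbers and their ambiguity. -/

theorem IsArg.mul {z z' : ℂ} {x x' : ℝ} (h : IsArg z x) (h' : IsArg z' x') :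
    IsArg (z * z') (x + x') := by
  unfold IsArg at *
  rw [norm_mul, Complex.ofReal_add, add_mul, Complex.exp_add, Complex.ofReal_mul]
  conv_lhs => rw [h, h']
  ring

theorem isArg_ofReal {r : ℝ} (hr : 0 ≤ r) : IsArg (r : ℂ) 0 := by
  simp [IsArg, abs_of_nonneg hr]

theorem isArg_exp (x : ℝ) : IsArg (Complex.exp (x * Complex.I)) x := by
  simp [IsArg, Complex.norm_exp]

theorem IsArg.conj {z : ℂ} {x : ℝ} (h : IsArg z x) : IsArg (conj z) (-x) := by
  unfold IsArg at *
  conv_lhs => rw [h]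
  simp [← Complex.exp_conj]

theorem IsArg.sub_mem {z : ℂ} {x y : ℝ} (h : IsArg z x) (h' : IsArg z y) (hz : z ≠ 0) :
    ∃ n : ℤ, x - y = n * (2 * Real.pi) := by
  unfold IsArg at *
  have hn : (‖z‖ : ℂ) ≠ 0 := by simpa using hz
  have : Complex.exp (x * Complex.I) = Complex.exp (y * Complex.I) :=
    mul_left_cancel₀ hn (h.symm.trans h')
  obtain ⟨n, hn⟩ := Complex.exp_eq_exp_iff_exists_int.mp this
  refine ⟨n, ?_⟩
  have := congrArg Complex.im hn
  simp at this
  linarith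

/-- After normalization all values are integers, whereas a nonconstant connected image would contain
some `a + 1/2`. -/
theorem eq_of_continuousOn_of_mem_zmultiples {f : ℝ → ℝ} {s : Set ℝ} (hs : IsPreconnected s)
    {c d : ℝ} (hc : 0 < c) (hf : ContinuousOn f s) (h : ∀ x ∈ s, ∃ n : ℤ, f x = d + n * c)
    {x y : ℝ} (hx : x ∈ s) (hy : y ∈ s) : f x = f y := by
  have : IsPreconnected ((fun z => (f z - d) / c) '' s) :=
    hs.image _ ((hf.sub continuousOn_const).div_const c)
  obtain ⟨a, ha⟩ := h x hx
  obtain ⟨b, hb⟩ := h y hy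
  have hval : ∀ (z : ℝ) (n : ℤ), f z = d + n * c → (f z - d) / c = n := by
    intro z n hz
    rw [hz]; field_simp; ring
  have key : ∀ a b : ℤ, (a : ℝ) ∈ (fun z => (f z - d) / c) '' s →
      (b : ℝ) ∈ (fun z => (f z - d) / c) '' s → ¬ a < b := by
    intro a b ha hb hab
    have hab' : (a : ℝ) + 1 ≤ b := by exact_mod_cast hab
    obtain ⟨z, hz, hz'⟩ := this.ordConnected.out ha hb
      (show (a : ℝ) + 1 / 2 ∈ Set.Icc (a : ℝ) b from ⟨by linarith, by linarith⟩)
    obtain ⟨n, hn⟩ := h z hz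
    simp only [hval z n hn] at hz'
    have h1 : (a : ℝ) < n := by linarith
    have h2 : (n : ℝ) < a + 1 := by linarith
    norm_cast at h1 h2
    omega
  have hxa : (a : ℝ) ∈ (fun z => (f z - d) / c) '' s := ⟨x, hx, hval x a ha⟩
  have hyb : (b : ℝ) ∈ (fun z => (f z - d) / c) '' s := ⟨y, hy, hval y b hb⟩
  have : a = b := le_antisymm (not_lt.mp (key b a hyb hxa)) (not_lt.mp (key a b hxa hyb))
  rw [ha, hb, this]

/-- Along a path of accretive matrices, `argDet` changes like any continuous argument of the
determinant. -/
theorem argDet_sub_argDet {γ : ℝ → Matrix k k ℂ} {φ : ℝ → ℝ} {a b : ℝ} (hab : a ≤ b)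
    (hγ : ContinuousOn γ (Set.Icc a b)) (hφ : ContinuousOn φ (Set.Icc a b))
    (hmem : ∀ t ∈ Set.Icc a b, γ t ∈ accretive k)
    (harg : ∃ z : ℂ, ∀ t ∈ Set.Icc a b, ∃ r : ℝ, 0 < r ∧
      (γ t).det = r * Complex.exp (φ t * Complex.I) * z) :
    argDet (γ b) - argDet (γ a) = φ b - φ a := by
  obtain ⟨z, hz⟩ := harg
  have hcont : ContinuousOn (fun t => argDet (γ t) - φ t) (Set.Icc a b) :=
    (continuousOn_argDet.comp hγ hmem).sub hφ
  have ha : a ∈ Set.Icc a b := ⟨le_rfl, hab⟩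
  have hb : b ∈ Set.Icc a b := ⟨hab, le_rfl⟩
  have hzarg : IsArg z z.arg := by
    unfold IsArg; rw [Complex.norm_mul_exp_arg_mul_I]
  have := eq_of_continuousOn_of_mem_zmultiples isPreconnected_Icc (c := 2 * Real.pi)
    (d := z.arg) (by positivity) hcont (fun t ht => by
      obtain ⟨r, hr, hdet⟩ := hz t ht
      have h1 : IsArg (γ t).det (0 + φ t + z.arg) := by
        rw [hdet]
        exact ((isArg_ofReal hr.le).mul (isArg_exp _)).mul hzarg
      obtain ⟨n, hn⟩ := (isArg_argDet (hmem t ht)).sub_mem h1 (hmem t ht).2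
      exact ⟨n, by linarith⟩) ha hb
  linarith

end Accretive

/-! ### Spectral splitting at a crossing -/

section Jump

variable {k : Type*} [Fintype k] [DecidableEq k]

theorem exists_unitary_diagonalization {G : Matrix k k ℂ} (hG : Gᴴ = G) :
    ∃ (U : Matrix k k ℂ) (ev : k → ℝ), Uᴴ * U = 1 ∧ U * Uᴴ = 1 ∧
      G = U * Matrix.diagonal (fun j => (ev j : ℂ)) * Uᴴ := by
  have hG' : G.IsHermitian := hG
  refine ⟨hG'.eigenvectorUnitary, hG'.eigenvalues, ?_, ?_, ?_⟩
  · exact Unitary.coe_star_mul_self hG'.eigenvectorUnitary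
  · exact Unitary.coe_mul_star_self hG'.eigenvectorUnitary
  · conv_lhs => rw [hG'.spectral_theorem, Unitary.conjStarAlgAut_apply]
    rfl

open scoped ComplexOrder in
/-- The orthogonal projection to the kernel of `ψ - 1`, for a unitary matrix `ψ`. -/
theorem exists_kernel_projection {ψ : Matrix k k ℂ} (hψ : ψᴴ * ψ = 1) :
    ∃ P : Matrix k k ℂ, Pᴴ = P ∧ P * P = P ∧ ψ * P = P ∧ P * ψ = P ∧
      ∀ v : k → ℂ, ψ *ᵥ v = v → P *ᵥ v = v := by
  have hψ' : ψ * ψᴴ = 1 := mul_eq_one_comm.mp hψ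
  -- As `ψ` is normal, also `A = (1 - ψ) (1 - ψ)ᴴ`; hence the spectral projection of `A` at the
  -- eigenvalue `0` is killed by `1 - ψ` from both sides.
  set A : Matrix k k ℂ := (1 - ψ)ᴴ * (1 - ψ) with hA
  have hA' : A = (1 - ψ) * (1 - ψ)ᴴ := by
    simp only [hA, Matrix.conjTranspose_sub, Matrix.conjTranspose_one, mul_sub, sub_mul, mul_one,
      one_mul, hψ, hψ']
    abel
  obtain ⟨U, ev, hU, hU', hUA⟩ := exists_unitary_diagonalization
    (G := A) (by simp [hA, Matrix.conjTranspose_mul])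
  set χ : k → ℂ := fun j => if ev j = 0 then 1 else 0 with hχ
  set P : Matrix k k ℂ := U * Matrix.diagonal χ * Uᴴ with hP
  have hPH : Pᴴ = P := by
    have : star χ = χ := by
      funext j; simp only [hχ, Pi.star_apply]; split_ifs <;> simp
    simp [hP, Matrix.conjTranspose_mul, Matrix.diagonal_conjTranspose, this, mul_assoc]
  have hPP : P * P = P := by
    calc P * P = U * Matrix.diagonal χ * (Uᴴ * U) * Matrix.diagonal χ * Uᴴ := by
          simp only [hP, mul_assoc]
      _ = P := by
          rw [hU, mul_one, mul_assoc U, Matrix.diagonal_mul_diagonal, hP]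
          congr 3
          funext j
          simp only [hχ]; split_ifs <;> simp
  have hAP : A * P = 0 := by
    calc A * P = U * Matrix.diagonal (fun j => (ev j : ℂ)) * (Uᴴ * U) * Matrix.diagonal χ * Uᴴ := by
          simp only [hP, hUA, mul_assoc]
      _ = 0 := by
          rw [hU, mul_one, mul_assoc U, Matrix.diagonal_mul_diagonal]
          have : (fun j => (ev j : ℂ) * χ j) = 0 := by
            funext j
            simp only [hχ]; split_ifs with hj <;> simp [hj]
          rw [this]
          simp
  have h1 : (1 - ψ) * P = 0 := by
    rw [← Matrix.conjTranspose_mul_self_eq_zero, Matrix.conjTranspose_mul, mul_assoc,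
      ← mul_assoc (1 - ψ)ᴴ, ← hA, hAP, mul_zero]
  have h2 : P * (1 - ψ) = 0 := by
    rw [← Matrix.self_mul_conjTranspose_eq_zero, Matrix.conjTranspose_mul, mul_assoc,
      ← mul_assoc (1 - ψ), ← hA', hPH, hAP, mul_zero]
  refine ⟨P, hPH, hPP, ?_, ?_, fun v hv => ?_⟩
  · rw [sub_mul, one_mul, sub_eq_zero] at h1
    exact h1.symm
  · rw [mul_sub, mul_one, sub_eq_zero] at h2
    exact h2.symm
  · have hAv : A *ᵥ v = 0 := by
      rw [hA, ← Matrix.mulVec_mulVec, Matrix.sub_mulVec, hv]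
      simp
    have h3 : Matrix.diagonal (fun j => (ev j : ℂ)) *ᵥ (Uᴴ *ᵥ v) = 0 := by
      have : Matrix.diagonal (fun j => (ev j : ℂ)) *ᵥ (Uᴴ *ᵥ v) = Uᴴ *ᵥ (A *ᵥ v) := by
        rw [hUA]
        simp only [Matrix.mulVec_mulVec]
        congr 1
        rw [← mul_assoc, ← mul_assoc, hU, one_mul]
      rw [this, hAv, Matrix.mulVec_zero]
    have h4 : Matrix.diagonal χ *ᵥ (Uᴴ *ᵥ v) = Uᴴ *ᵥ v := by
      funext j
      have := congrFun h3 j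
      simp only [Matrix.mulVec_diagonal, Pi.zero_apply, mul_eq_zero, Complex.ofReal_eq_zero]
        at this ⊢
      rcases this with h | h
      · simp [hχ, h]
      · simp [h]
    rw [hP, ← Matrix.mulVec_mulVec, ← Matrix.mulVec_mulVec, h4, Matrix.mulVec_mulVec, hU',
      Matrix.one_mulVec]

/-! ### Congruence and stretching of accretive matrices. -/

omit [DecidableEq k] in
theorem star_dotProduct_congr (D M : Matrix k k ℂ) (v : k → ℂ) :
    star v ⬝ᵥ (Dᴴ * M * D) *ᵥ v = star (D *ᵥ v) ⬝ᵥ M *ᵥ (D *ᵥ v) := by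
  rw [Matrix.star_mulVec, ← Matrix.dotProduct_mulVec, Matrix.mulVec_mulVec, Matrix.mulVec_mulVec,
    mul_assoc]

theorem congr_mem_accretive {M D : Matrix k k ℂ} (hM : M ∈ accretive k) (hD : D.det ≠ 0) :
    Dᴴ * M * D ∈ accretive k := by
  refine ⟨fun v => ?_, ?_⟩
  · rw [star_dotProduct_congr]
    exact hM.1 _
  · rw [Matrix.det_mul, Matrix.det_mul, Matrix.det_conjTranspose]
    exact mul_ne_zero (mul_ne_zero (star_ne_zero.mpr hD) hM.2) hD

/-- Rescaling of the range of a projection `P` by the factor `x`. -/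
def stretch (P : Matrix k k ℂ) (x : ℝ) : Matrix k k ℂ := 1 + (x - 1) • P

theorem stretch_mul_stretch {P : Matrix k k ℂ} (hP : P * P = P) (x y : ℝ) :
    stretch P x * stretch P y = stretch P (x * y) := by
  simp only [stretch, add_mul, mul_add, one_mul, mul_one, smul_mul_assoc, mul_smul_comm, hP]
  module

theorem det_stretch_ne_zero {P : Matrix k k ℂ} (hP : P * P = P) {x : ℝ} (hx : 0 < x) :
    (stretch P x).det ≠ 0 := by
  have h := congrArg Matrix.det (stretch_mul_stretch hP x x⁻¹)
  rw [mul_inv_cancel₀ hx.ne', Matrix.det_mul] at h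
  intro h0
  rw [h0, zero_mul] at h
  simp [stretch] at h

omit [Fintype k] in
theorem conjTranspose_stretch {P : Matrix k k ℂ} (hP : Pᴴ = P) (x : ℝ) :
    (stretch P x)ᴴ = stretch P x := by
  simp [stretch, Matrix.conjTranspose_add, Matrix.conjTranspose_smul, hP]

/-- A stretch is Hermitian, so its determinant is real and the congruence multiplies `M.det` by a
positive number. Deforming the factor `x` to `1` transfers this to the continuous argument. -/
theorem argDet_stretch {P M : Matrix k k ℂ} (hP : P * P = P) (hP' : Pᴴ = P) {x : ℝ} (hx : 0 < x)
    (hM : M ∈ accretive k) : argDet (stretch P x * M * stretch P x) = argDet M := by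
  have hpos : ∀ τ ∈ Set.Icc (0 : ℝ) 1, 0 < 1 + τ * (x - 1) := by
    rintro τ ⟨h0, h1⟩
    rcases eq_or_lt_of_le h0 with rfl | h0
    · simp
    · nlinarith [mul_pos h0 hx]
  have h := argDet_sub_argDet (a := 0) (b := 1) zero_le_one
    (γ := fun τ => stretch P (1 + τ * (x - 1)) * M * stretch P (1 + τ * (x - 1)))
    (φ := fun _ => 0) ?_ continuousOn_const ?_ ⟨M.det, fun τ hτ => ?_⟩
  · have h0 : stretch P 1 = 1 := by simp [stretch]
    simp only [zero_mul, add_zero, h0, one_mul, mul_one, add_sub_cancel, sub_self] at h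
    linarith
  · refine Continuous.continuousOn ?_
    unfold stretch
    fun_prop
  · intro τ hτ
    have := congr_mem_accretive hM (det_stretch_ne_zero hP (hpos τ hτ))
    rwa [conjTranspose_stretch hP'] at this
  · set D := stretch P (1 + τ * (x - 1))
    have hD : D.det ≠ 0 := det_stretch_ne_zero hP (hpos τ hτ)
    have hD' : conj D.det = D.det := by
      rw [← Complex.star_def, ← Matrix.det_conjTranspose, conjTranspose_stretch hP']
    refine ⟨Complex.normSq D.det, Complex.normSq_pos.mpr hD, ?_⟩
    rw [Complex.normSq_eq_conj_mul_self, hD', Matrix.det_mul, Matrix.det_mul]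
    simp
    ring

/-- The change of `argDet` under a rotation of the Hermitian form `G` across the kernel of `Z`. -/
theorem exists_argDet_eq_sign_sum {Z G P U : Matrix k k ℂ} {ev : k → ℝ}
    (hZ : ∀ v : k → ℂ, 0 ≤ (star v ⬝ᵥ Z *ᵥ v).re) (hU : Uᴴ * U = 1)
    (hG : G = U * Matrix.diagonal (fun j => (ev j : ℂ)) * Uᴴ) (hZG : Z * G = 0) (hGZ : G * Z = 0)
    (hker : ∀ v : k → ℂ, Z *ᵥ v = 0 → P *ᵥ v = v) (hreg : ∀ v : k → ℂ, G *ᵥ v = 0 → P *ᵥ v = 0) :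
    Z - Complex.I • G ∈ accretive k ∧ Z + Complex.I • G ∈ accretive k ∧
    ∃ b : ℝ, argDet (Z - Complex.I • G) = b - Real.pi / 2 * ∑ j, Real.sign (ev j) ∧
      argDet (Z + Complex.I • G) = b + Real.pi / 2 * ∑ j, Real.sign (ev j) ∧ (Z = 0 → b = 0) := by
  have hU' : U * Uᴴ = 1 := mul_eq_one_comm.mp hU
  have hdetU : U.det * Uᴴ.det = 1 := by rw [← Matrix.det_mul, hU', Matrix.det_one]
  -- At `θ = ±π/2` the number `|ev j|` times this phase is `±i ev j`, so `A` joins `Z - iG` to `Z +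
  -- iG`; in between the phases have nonnegative real part.
  set u : ℝ → k → ℂ := fun θ j => Complex.exp ((θ * Real.sign (ev j) : ℝ) * Complex.I) with hu
  set A : ℝ → Matrix k k ℂ := fun θ =>
    Z + U * Matrix.diagonal (fun j => ((|ev j| : ℝ) : ℂ) * u θ j) * Uᴴ with hA
  have hdiag : ∀ (d : k → ℂ) (v : k → ℂ), star v ⬝ᵥ (U * Matrix.diagonal d * Uᴴ) *ᵥ v
      = ∑ j, d j * (‖(Uᴴ *ᵥ v) j‖ ^ 2 : ℝ) := by
    intro d v
    have := star_dotProduct_congr Uᴴ (Matrix.diagonal d) v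
    rw [Matrix.conjTranspose_conjTranspose] at this
    rw [this, dotProduct]
    refine Finset.sum_congr rfl fun j _ => ?_
    rw [Matrix.mulVec_diagonal, Pi.star_apply, Complex.star_def, Complex.ofReal_pow,
      ← Complex.conj_mul']
    ring
  have hfac : ∀ θ, A θ = A 0 * (U * Matrix.diagonal (u θ) * Uᴴ) := by
    intro θ
    have h0 : u 0 = 1 := by funext j; simp [hu]
    have h1 : Z * (U * Matrix.diagonal (u θ) * Uᴴ) = Z := by
      -- Where `ev j = 0` the phase is `1`, so the division there is harmless; the correction
      -- factors through `G`, which `Z` annihilates.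
      have : Matrix.diagonal (u θ) = 1 + Matrix.diagonal (fun j => (ev j : ℂ)) *
          Matrix.diagonal (fun j => (u θ j - 1) / (ev j : ℂ)) := by
        rw [Matrix.diagonal_mul_diagonal, ← Matrix.diagonal_one, Matrix.diagonal_add]
        congr 1
        funext j
        by_cases hj : ev j = 0
        · simp [hj, hu]
        · have : (ev j : ℂ) ≠ 0 := by exact_mod_cast hj
          field_simp
          ring
      calc Z * (U * Matrix.diagonal (u θ) * Uᴴ)
          = Z * (U * Uᴴ) + Z * (U * Matrix.diagonal (fun j => (ev j : ℂ)) * (Uᴴ * U)) *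
            Matrix.diagonal (fun j => (u θ j - 1) / (ev j : ℂ)) * Uᴴ := by
            rw [this, hU, mul_one]
            simp only [mul_add, add_mul, mul_one, mul_assoc]
        _ = Z * (U * Uᴴ) + Z * G * U *
            Matrix.diagonal (fun j => (u θ j - 1) / (ev j : ℂ)) * Uᴴ := by
            rw [hG]; simp only [mul_assoc]
        _ = Z := by rw [hZG, hU']; simp
    have h2 : U * Matrix.diagonal (fun j => ((|ev j| : ℝ) : ℂ) * u 0 j) * Uᴴ *
        (U * Matrix.diagonal (u θ) * Uᴴ) =
        U * Matrix.diagonal (fun j => ((|ev j| : ℝ) : ℂ) * u θ j) * Uᴴ := by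
      calc _ = U * (Matrix.diagonal (fun j => ((|ev j| : ℝ) : ℂ) * u 0 j) * (Uᴴ * U) *
              Matrix.diagonal (u θ)) * Uᴴ := by simp only [mul_assoc]
        _ = _ := by
          rw [hU, mul_one, Matrix.diagonal_mul_diagonal]
          simp [h0]
    simp only [hA, add_mul, h1, h2]
  have hdet : ∀ θ, (A θ).det = Complex.exp ((θ * ∑ j, Real.sign (ev j) : ℝ) * Complex.I) *
      (A 0).det := by
    intro θ
    rw [hfac θ, Matrix.det_mul, Matrix.det_mul, Matrix.det_mul, Matrix.det_diagonal, hu,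
      ← Complex.exp_sum, ← Finset.sum_mul, ← Complex.ofReal_sum, ← Finset.mul_sum]
    linear_combination (A 0).det *
      Complex.exp ((θ * ∑ j, Real.sign (ev j) : ℝ) * Complex.I) * hdetU
  -- Applying `G` to `A 0 v = 0` removes `Z` and forces `G v = 0`; then `Z v = 0` too, whence `v = P
  -- v = 0`.
  have hA0 : (A 0).det ≠ 0 := by
    intro h0
    obtain ⟨v, hv, hv'⟩ := Matrix.exists_mulVec_eq_zero_iff.mpr h0
    have hA0v : A 0 *ᵥ v = Z *ᵥ v + U *ᵥ (fun j => ((|ev j| : ℝ) : ℂ) * (Uᴴ *ᵥ v) j) := by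
      simp only [hA, Matrix.add_mulVec, ← Matrix.mulVec_mulVec]
      congr 2
      funext j
      simp [Matrix.mulVec_diagonal, hu]
    have h1 : G *ᵥ (A 0 *ᵥ v) = U *ᵥ (fun j => (ev j : ℂ) * (((|ev j| : ℝ) : ℂ) * (Uᴴ *ᵥ v) j)) := by
      rw [hA0v, Matrix.mulVec_add, Matrix.mulVec_mulVec, hGZ, Matrix.zero_mulVec, zero_add, hG,
        ← Matrix.mulVec_mulVec, ← Matrix.mulVec_mulVec, Matrix.mulVec_mulVec _ Uᴴ U, hU,
        Matrix.one_mulVec]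
      congr 1
      funext j
      simp [Matrix.mulVec_diagonal]
    rw [hv', Matrix.mulVec_zero] at h1
    have h2 : ∀ j, (ev j : ℂ) * (Uᴴ *ᵥ v) j = 0 := by
      intro j
      have h3 := congrArg (Uᴴ *ᵥ ·) h1
      simp only [Matrix.mulVec_mulVec, hU, Matrix.one_mulVec, Matrix.mulVec_zero] at h3
      have h4 := congrFun h3 j
      simp only [Pi.zero_apply, zero_eq_mul, mul_eq_zero, Complex.ofReal_eq_zero, abs_eq_zero] at h4
      simp only [mul_eq_zero, Complex.ofReal_eq_zero]
      tauto
    have h5 : G *ᵥ v = 0 := by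
      rw [hG, ← Matrix.mulVec_mulVec, ← Matrix.mulVec_mulVec]
      have : Matrix.diagonal (fun j => (ev j : ℂ)) *ᵥ (Uᴴ *ᵥ v) = 0 := by
        funext j
        simpa [Matrix.mulVec_diagonal] using h2 j
      rw [this, Matrix.mulVec_zero]
    have h6 : (fun j => ((|ev j| : ℝ) : ℂ) * (Uᴴ *ᵥ v) j) = 0 := by
      funext j
      have := h2 j
      simp only [Pi.zero_apply, mul_eq_zero, Complex.ofReal_eq_zero, abs_eq_zero] at this ⊢
      exact this
    rw [hv', h6, Matrix.mulVec_zero, add_zero] at hA0v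
    exact hv ((hker v hA0v.symm).symm.trans (hreg v h5))
  have hmem : ∀ θ ∈ Set.Icc (-(Real.pi / 2)) (Real.pi / 2), A θ ∈ accretive k := by
    rintro θ ⟨hθ, hθ'⟩
    refine ⟨fun v => ?_, ?_⟩
    · simp only [hA, Matrix.add_mulVec, dotProduct_add, Complex.add_re, hdiag, Complex.re_sum]
      refine add_nonneg (hZ v) (Finset.sum_nonneg fun j _ => ?_)
      rw [Complex.re_mul_ofReal, Complex.re_ofReal_mul, hu]
      simp only [Complex.exp_ofReal_mul_I_re]
      have : 0 ≤ Real.cos (θ * Real.sign (ev j)) := by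
        rcases Real.sign_apply_eq (ev j) with h | h | h <;> rw [h] <;>
          simp only [mul_neg, mul_one, mul_zero, Real.cos_neg, Real.cos_zero, zero_le_one] <;>
          exact Real.cos_nonneg_of_mem_Icc ⟨hθ, hθ'⟩
      positivity
    · rw [hdet]
      exact mul_ne_zero (Complex.exp_ne_zero _) hA0
  have hcont : Continuous A := by
    simp only [hA, hu]
    refine continuous_const.add (Continuous.matrix_mul (Continuous.matrix_mul continuous_const
      (Continuous.matrix_diagonal ?_)) continuous_const)
    fun_prop
  have hpi := Real.pi_pos
  have hsgn : ∀ x : ℝ, ((|x| : ℝ) : ℂ) * (Real.sign x : ℂ) = x := by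
    intro x
    rcases lt_trichotomy x 0 with h | h | h
    · rw [Real.sign_of_neg h, abs_of_neg h]; simp
    · simp [h]
    · rw [Real.sign_of_pos h, abs_of_pos h]; simp
  have hexp : ∀ (e : ℝ), e = 1 ∨ e = -1 → ∀ x : ℝ,
      ((|x| : ℝ) : ℂ) * Complex.exp ((e * (Real.pi / 2) * Real.sign x : ℝ) * Complex.I)
      = e * Complex.I * x := by
    intro e he x
    have h1 : Complex.exp ((Real.pi / 2 : ℂ) * Complex.I) = Complex.I :=
      Complex.exp_pi_div_two_mul_I
    have h2 : Complex.exp (-((Real.pi / 2 : ℂ) * Complex.I)) = -Complex.I := by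
      rw [Complex.exp_neg, h1, Complex.inv_I]
    rw [← hsgn x]
    rcases lt_trichotomy x 0 with h | rfl | h
    · rcases he with he | he <;> simp [Real.sign_of_neg h, he, h1, h2] <;> ring
    · simp
    · rcases he with he | he <;> simp [Real.sign_of_pos h, he, h1, h2] <;> ring
  have hplus : A (Real.pi / 2) = Z + Complex.I • G := by
    simp only [hA, hu, hG]
    congr 1
    rw [← smul_mul_assoc, ← mul_smul_comm, ← Matrix.diagonal_smul]
    congr 3
    funext j
    have := hexp 1 (Or.inl rfl) (ev j)
    simp only [one_mul, Complex.ofReal_one] at this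
    simpa using this
  have hminus : A (-(Real.pi / 2)) = Z - Complex.I • G := by
    simp only [hA, hu, hG]
    rw [sub_eq_add_neg, ← neg_smul]
    congr 1
    rw [← smul_mul_assoc, ← mul_smul_comm, ← Matrix.diagonal_smul]
    congr 3
    funext j
    have := hexp (-1) (Or.inr rfl) (ev j)
    simp only [neg_mul, one_mul, Complex.ofReal_one, Complex.ofReal_neg] at this ⊢
    simpa using this
  have hdiff : ∀ a b : ℝ, -(Real.pi / 2) ≤ a → a ≤ b → b ≤ Real.pi / 2 →
      argDet (A b) - argDet (A a) = b * (∑ j, Real.sign (ev j)) - a * ∑ j, Real.sign (ev j) := by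
    intro a b ha hab hb
    refine argDet_sub_argDet (φ := fun θ => θ * ∑ j, Real.sign (ev j)) hab hcont.continuousOn
      (by fun_prop) (fun t ht => hmem t ⟨ha.trans ht.1, ht.2.trans hb⟩)
      ⟨(A 0).det, fun t _ => ⟨1, one_pos, ?_⟩⟩
    rw [hdet]; simp
  rw [← hplus, ← hminus]
  refine ⟨hmem _ ⟨le_rfl, by linarith⟩, hmem _ ⟨by linarith, le_rfl⟩, argDet (A 0), ?_, ?_, ?_⟩
  · have := hdiff (-(Real.pi / 2)) 0 le_rfl (by linarith) (by linarith)
    linarith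
  · have := hdiff 0 (Real.pi / 2) (by linarith) (by linarith) le_rfl
    linarith
  -- Now `A 0` is `|G|`, and the determinant is real and positive on the whole segment from `1` to
  -- it.
  · intro hZ0
    have hm := hmem 0 ⟨by linarith, by linarith⟩
    have h := argDet_sub_argDet (a := 0) (b := 1) zero_le_one
      (γ := fun τ => (1 - τ) • (1 : Matrix k k ℂ) + τ • A 0)
      (φ := fun _ => 0) (by fun_prop) continuousOn_const
      (fun τ hτ => one_add_smul_mem_accretive hm hτ.1 hτ.2) ⟨1, fun τ hτ => ?_⟩
    · simpa [argDet_one] using h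
    · have h1 : (1 - τ) • (1 : Matrix k k ℂ) + τ • A 0
          = U * Matrix.diagonal (fun j => (((1 - τ) + τ * |ev j| : ℝ) : ℂ)) * Uᴴ := by
        have : Matrix.diagonal (fun j => (((1 - τ) + τ * |ev j| : ℝ) : ℂ)) =
            (1 - τ) • (1 : Matrix k k ℂ) + τ • Matrix.diagonal (fun j => ((|ev j| : ℝ) : ℂ)) := by
          rw [← Matrix.diagonal_one, ← Matrix.diagonal_smul, ← Matrix.diagonal_smul,
            Matrix.diagonal_add]
          congr 1
          funext j
          simp
        rw [this]
        simp only [hA, hZ0, zero_add, mul_add, add_mul, mul_smul_comm, smul_mul_assoc, mul_one,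
          hU', hu]
        simp
      have hd : ((1 - τ) • (1 : Matrix k k ℂ) + τ • A 0).det
          = ((∏ j, ((1 - τ) + τ * |ev j|) : ℝ) : ℂ) := by
        rw [h1, Matrix.det_mul, Matrix.det_mul, Matrix.det_diagonal, Complex.ofReal_prod]
        linear_combination (∏ j, (((1 - τ) + τ * |ev j| : ℝ) : ℂ)) * hdetU
      refine ⟨∏ j, ((1 - τ) + τ * |ev j|), lt_of_le_of_ne ?_ ?_, ?_⟩
      · refine Finset.prod_nonneg fun j _ => ?_
        have := hτ.1
        have : 0 ≤ 1 - τ := by linarith [hτ.2]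
        positivity
      · intro h0
        refine (one_add_smul_mem_accretive hm hτ.1 hτ.2).2 ?_
        rw [hd, ← h0, Complex.ofReal_zero]
      · rw [hd]; simp

end Jump

/-! ### Sums of jumps -/

section SumOfJumps

open Filter Set

/-- Discreteness turns a one-sided limit of `2 argDet (1 - ψ) - θ` into an exact value near the
crossing. -/
theorem eventually_eq_of_tendsto_of_mem_zmultiples {β : Type*} {l : Filter β} {f : β → ℝ}
    {x c d : ℝ} (hc : 0 < c) (hf : Tendsto f l (𝓝 x)) (h : ∀ᶠ s in l, ∃ n : ℤ, f s = d + n * c) :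
    ∀ᶠ s in l, f s = x := by
  rcases l.eq_or_neBot with rfl | hl
  · simp
  have h1 : ∀ᶠ s in l, |f s - x| < c / 2 := Metric.tendsto_nhds.mp hf _ (half_pos hc)
  obtain ⟨s₀, ⟨n₀, hn₀⟩, hs₀⟩ := (h.and h1).exists
  have h2 : ∀ᶠ s in l, f s = f s₀ := by
    filter_upwards [h, h1] with s ⟨n, hn⟩ hs
    have h3 : |f s - f s₀| < c := by
      rw [abs_lt] at *
      constructor <;> linarith
    have h4 : f s - f s₀ = ((n - n₀ : ℤ) : ℝ) * c := by push_cast; rw [hn, hn₀]; ring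
    rw [h4, abs_mul, abs_of_pos hc] at h3
    have h5 : |((n - n₀ : ℤ) : ℝ)| < 1 := by
      by_contra hcon
      nlinarith
    have h6 : n - n₀ = 0 := by
      rw [← Int.abs_lt_one_iff]
      exact_mod_cast h5
    rw [hn, hn₀, sub_eq_zero.mp h6]
  have h3 : f s₀ = x := tendsto_nhds_unique (tendsto_const_nhds.congr' (h2.mono fun s hs => hs.symm)) hf
  exact h2.mono fun s hs => hs.trans h3

/-- Here `2 c t` is the drop of `g` across `t` and `B t` the midpoint. A step function that undoes
the drops makes `B` constant inside the interval; comparison near the two ends leaves a half drop at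
each. -/
theorem sum_of_jumps {g B c : ℝ → ℝ}
    (hr : ∀ t ∈ Ico (0 : ℝ) 1, ∀ᶠ s in 𝓝[>] t, g s = B t - c t)
    (hl : ∀ t ∈ Ioc (0 : ℝ) 1, ∀ᶠ s in 𝓝[<] t, g s = B t + c t) :
    B 1 + c 1 - (B 0 - c 0) = -2 * ∑ᶠ t ∈ Ioo (0 : ℝ) 1, c t := by
  -- Where `g` is locally constant, `B s - c s = v = B s + c s`.
  have point : ∀ s ∈ Ioo (0 : ℝ) 1, ∀ v, (∀ᶠ r in 𝓝 s, g r = v) → c s = 0 ∧ B s = v := by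
    intro s hs v hv
    obtain ⟨r, h1, h2⟩ := ((hr s ⟨hs.1.le, hs.2⟩).and (hv.filter_mono nhdsWithin_le_nhds)).exists
    obtain ⟨r', h3, h4⟩ := ((hl s ⟨hs.1, hs.2.le⟩).and (hv.filter_mono nhdsWithin_le_nhds)).exists
    constructor <;> linarith
  have right : ∀ t ∈ Ico (0 : ℝ) 1, ∀ᶠ s in 𝓝[>] t, c s = 0 ∧ B s = B t - c t := by
    intro t ht
    have h1 := eventually_eventually_nhdsWithin.mpr (hr t ht)
    filter_upwards [h1, Ioo_mem_nhdsGT ht.2] with s hs hs'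
    rw [isOpen_Ioi.nhdsWithin_eq (show s ∈ Ioi t from hs'.1)] at hs
    exact point s ⟨ht.1.trans_lt hs'.1, hs'.2⟩ _ hs
  have left : ∀ t ∈ Ioc (0 : ℝ) 1, ∀ᶠ s in 𝓝[<] t, c s = 0 ∧ B s = B t + c t := by
    intro t ht
    have h1 := eventually_eventually_nhdsWithin.mpr (hl t ht)
    filter_upwards [h1, Ioo_mem_nhdsLT ht.1] with s hs hs'
    rw [isOpen_Iio.nhdsWithin_eq (show s ∈ Iio t from hs'.2)] at hs
    exact point s ⟨hs'.1, hs'.2.trans_le ht.2⟩ _ hs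
  -- The one-sided statements exclude accumulation points of the support in `[0, 1]`. Finiteness
  -- matters, since otherwise the `finsum` takes its default value `0`.
  have hfin : (Ioo (0 : ℝ) 1 ∩ Function.support c).Finite := by
    by_contra hinf
    obtain ⟨t, ht, hacc⟩ := Set.Infinite.exists_accPt_of_subset_isCompact
      (s := Ioo (0 : ℝ) 1 ∩ Function.support c) hinf isCompact_Icc
      (inter_subset_left.trans Ioo_subset_Icc_self)
    rw [accPt_iff_frequently_nhdsNE] at hacc
    refine hacc ?_
    rw [← Iio_union_Ioi, nhdsWithin_union, eventually_sup]
    constructor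
    · rcases eq_or_lt_of_le ht.1 with h | h
      · filter_upwards [self_mem_nhdsWithin] with s hs hs'
        rw [← h] at hs
        exact (hs'.1.1.trans (show s < 0 from hs)).false
      · filter_upwards [left t ⟨h, ht.2⟩] with s hs hs'
        exact hs'.2 hs.1
    · rcases eq_or_lt_of_le ht.2 with h | h
      · filter_upwards [self_mem_nhdsWithin] with s hs hs'
        rw [h] at hs
        exact (hs'.1.2.trans (show 1 < s from hs)).false
      · filter_upwards [right t ⟨ht.1, h⟩] with s hs hs'
        exact hs'.2 hs.1
  set S := hfin.toFinset with hS
  have hmemS : ∀ u, u ∈ S ↔ u ∈ Ioo (0 : ℝ) 1 ∧ c u ≠ 0 := by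
    intro u; simp [hS]
  have hsum : ∑ᶠ t ∈ Ioo (0 : ℝ) 1, c t = ∑ u ∈ S, c u := by
    rw [← finsum_mem_inter_support]
    exact finsum_mem_eq_finite_toFinset_sum c hfin
  -- The term of `u` is `0` before `u`, `c u` at `u` and `2 * c u` after it, which cancels the drop
  -- of `B` at `u`.
  set E : ℝ → ℝ := fun t => ∑ u ∈ S, c u * (1 + Real.sign (t - u)) with hE
  have hsign : ∀ t : ℝ, ∀ u ∈ S, u ≠ t → ∀ᶠ s in 𝓝 t, Real.sign (s - u) = Real.sign (t - u) := by
    intro t u _ hut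
    rcases lt_or_gt_of_ne hut with h | h
    · filter_upwards [Ioi_mem_nhds h] with s hs
      rw [Real.sign_of_pos (sub_pos.mpr hs), Real.sign_of_pos (sub_pos.mpr h)]
    · filter_upwards [Iio_mem_nhds h] with s hs
      rw [Real.sign_of_neg (sub_neg.mpr hs), Real.sign_of_neg (sub_neg.mpr h)]
  have hsign' : ∀ t : ℝ, ∀ᶠ s in 𝓝 t, ∀ u ∈ S, u ≠ t → Real.sign (s - u) = Real.sign (t - u) := by
    intro t
    rw [Filter.eventually_all_finset]
    intro u hu
    by_cases hut : u = t
    · simp [hut]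
    · filter_upwards [hsign t u hu hut] with s hs _ using hs
  have hEstep : ∀ t ∈ Ioo (0 : ℝ) 1, ∀ᶠ s in 𝓝 t, E s = E t + c t * Real.sign (s - t) := by
    intro t ht
    filter_upwards [hsign' t] with s hs
    by_cases htS : t ∈ S
    · simp only [hE]
      rw [← Finset.add_sum_erase _ _ htS, ← Finset.add_sum_erase S (fun u => c u * (1 + Real.sign (t - u))) htS,
        Finset.sum_congr rfl (fun u hu => by
          rw [hs u (Finset.mem_of_mem_erase hu) (Finset.ne_of_mem_erase hu)])]
      simp
      ring
    · have hct : c t = 0 := by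
        by_contra h
        exact htS ((hmemS t).mpr ⟨ht, h⟩)
      simp only [hE, hct, zero_mul, add_zero]
      exact Finset.sum_congr rfl fun u hu => by
        rw [hs u hu (fun h => htS (h ▸ hu))]
  have hloc : ∀ t ∈ Ioo (0 : ℝ) 1, (fun s => B s + E s) =ᶠ[𝓝 t] fun _ => B t + E t := by
    intro t ht
    have h1 := right t ⟨ht.1.le, ht.2⟩
    have h2 := left t ⟨ht.1, ht.2.le⟩
    rw [eventually_nhdsWithin_iff] at h1 h2
    filter_upwards [h1, h2, hEstep t ht] with s h1 h2 h3
    rcases lt_trichotomy s t with h | rfl | h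
    · rw [h3, (h2 h).2, Real.sign_of_neg (sub_neg.mpr h)]; ring
    · rfl
    · rw [h3, (h1 h).2, Real.sign_of_pos (sub_pos.mpr h)]; ring
  have hconst : ∀ x ∈ Ioo (0 : ℝ) 1, ∀ y ∈ Ioo (0 : ℝ) 1, B x + E x = B y + E y := by
    intro x hx y hy
    refine isOpen_Ioo.is_const_of_deriv_eq_zero isPreconnected_Ioo (f := fun s => B s + E s) ?_ ?_ hx hy
    · intro t ht
      exact ((hasDerivAt_const t _).congr_of_eventuallyEq (hloc t ht)).differentiableAt.differentiableWithinAt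
    · intro t ht
      exact ((hasDerivAt_const t _).congr_of_eventuallyEq (hloc t ht)).deriv
  obtain ⟨x, ⟨hx1, hx2⟩, hx3⟩ := ((right 0 ⟨le_rfl, one_pos⟩).and
    ((Ioo_mem_nhdsGT one_pos : Ioo (0 : ℝ) 1 ∈ 𝓝[>] 0))).and
    ((hsign' 0).filter_mono nhdsWithin_le_nhds) |>.exists
  obtain ⟨y, ⟨hy1, hy2⟩, hy3⟩ := ((left 1 ⟨one_pos, le_rfl⟩).and
    ((Ioo_mem_nhdsLT one_pos : Ioo (0 : ℝ) 1 ∈ 𝓝[<] 1))).and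
    ((hsign' 1).filter_mono nhdsWithin_le_nhds) |>.exists
  have hEx : E x = 0 := Finset.sum_eq_zero fun u hu => by
    have hu' := ((hmemS u).mp hu).1
    rw [hx3 u hu hu'.1.ne', Real.sign_of_neg (by linarith [hu'.1])]
    ring
  have hEy : E y = 2 * ∑ u ∈ S, c u := by
    rw [Finset.mul_sum]
    refine Finset.sum_congr rfl fun u hu => ?_
    have hu' := ((hmemS u).mp hu).1
    rw [hy3 u hu hu'.2.ne, Real.sign_of_pos (by linarith [hu'.2])]
    ring
  have := hconst x hx2 y hy2
  rw [hEx, hEy, hx1.2, hy1.2] at this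
  rw [hsum]
  linarith

end SumOfJumps

/-! ### The crossing form of a path of unitary matrices -/

section Crossing

open Filter Set

variable {k : Type*} [Fintype k] [DecidableEq k]

/-- A path of complex matrices, as a path of real linear maps. -/
def matrixPath (ψ : ℝ → Matrix k k ℂ) (t : ℝ) : (k → ℂ) →L[ℝ] (k → ℂ) :=
  LinearMap.toContinuousLinearMap ((ψ t).mulVecLin.restrictScalars ℝ)

omit [DecidableEq k] in
theorem mem_crossingSpace {ψ : ℝ → Matrix k k ℂ} {t : ℝ} {v : k → ℂ} :
    v ∈ crossingSpace (matrixPath ψ) t ↔ ψ t *ᵥ v = v := by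
  simp [crossingSpace, matrixPath, sub_eq_zero]

omit [DecidableEq k] in
theorem deriv_matrixPath {ψ : ℝ → Matrix k k ℂ} {ψ' : Matrix k k ℂ} {t : ℝ}
    (hψ : ∀ i j, HasDerivAt (fun s => ψ s i j) (ψ' i j) t) (v : k → ℂ) :
    deriv (matrixPath ψ) t v = ψ' *ᵥ v := by
  let L : (k → k → ℂ) →ₗ[ℝ] ((k → ℂ) →L[ℝ] (k → ℂ)) :=
    { toFun := fun A => LinearMap.toContinuousLinearMap
        ((Matrix.mulVecLin (Matrix.of A)).restrictScalars ℝ)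
      map_add' := by
        intro A B; ext v i
        exact congrFun (Matrix.add_mulVec (Matrix.of A) (Matrix.of B) v) i
      map_smul' := by
        intro c A; ext v i
        exact congrFun (Matrix.smul_mulVec c (Matrix.of A) v) i }
  have h1 : HasDerivAt (fun s => (fun i j => ψ s i j : k → k → ℂ)) (fun i j => ψ' i j) t :=
    hasDerivAt_pi.mpr fun i => hasDerivAt_pi.mpr fun j => hψ i j
  have h2 : HasDerivAt (matrixPath ψ) (L fun i j => ψ' i j) t :=
    (LinearMap.toContinuousLinearMap L).hasFDerivAt.comp_hasDerivAt t h1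
  rw [h2.deriv]
  rfl

omit [DecidableEq k] in
theorem crossingForm_matrixPath {ψ : ℝ → Matrix k k ℂ} {ψ' : Matrix k k ℂ} {t : ℝ}
    (hψ : ∀ i j, HasDerivAt (fun s => ψ s i j) (ψ' i j) t)
    (v : crossingSpace (matrixPath ψ) t) :
    crossingForm (matrixPath ψ) t v = (star (v : k → ℂ) ⬝ᵥ ψ' *ᵥ (v : k → ℂ)).im := by
  change stdSymp k v (deriv (matrixPath ψ) t v) = _
  rw [deriv_matrixPath hψ]
  rfl

-- The factor `Bool` records real and imaginary parts: each complex eigendirection counts twice in a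
-- real signature.
omit [DecidableEq k] in
theorem ncard_pos_sub_ncard_neg (ev : k → ℝ) :
    (({i : {j // ev j ≠ 0} × Bool | 0 < ev i.1}.ncard : ℝ) -
      ({i : {j // ev j ≠ 0} × Bool | ev i.1 < 0}.ncard : ℝ)) = 2 * ∑ j, Real.sign (ev j) := by
  classical
  have h : ∀ p : ℝ → Prop, ¬ p 0 → ({i : {j // ev j ≠ 0} × Bool | p (ev i.1)}.ncard : ℝ)
      = 2 * ∑ j, if p (ev j) then (1 : ℝ) else 0 := by
    intro p hp
    have h1 : ∑ j, (if p (ev j) then (1 : ℝ) else 0)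
        = ∑ j : {j // ev j ≠ 0}, if p (ev j) then (1 : ℝ) else 0 := by
      rw [← Finset.sum_filter_add_sum_filter_not Finset.univ (fun j => ev j ≠ 0),
        Finset.sum_subtype (p := fun j => ev j ≠ 0) _ (by simp), add_eq_left]
      refine Finset.sum_eq_zero fun j hj => ?_
      simp only [ne_eq, not_not, Finset.mem_filter, Finset.mem_univ, true_and] at hj
      simp [hj, hp]
    rw [h1, Set.ncard_eq_toFinset_card', Set.toFinset_ofPred, Finset.card_filter]
    push_cast
    rw [Fintype.sum_prod_type, Finset.mul_sum]
    refine Finset.sum_congr rfl fun j _ => ?_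
    simp only [Fintype.sum_bool]
    split_ifs <;> norm_num
  rw [h (fun x => 0 < x) (lt_irrefl 0), h (fun x => x < 0) (lt_irrefl 0), ← mul_sub,
    ← Finset.sum_sub_distrib]
  congr 1
  refine Finset.sum_congr rfl fun j _ => ?_
  rcases lt_trichotomy (ev j) 0 with h | h | h
  · simp [h, Real.sign_of_neg, h.not_gt]
  · simp [h]
  · simp [h, Real.sign_of_pos, h.not_gt]

/-- At a regular crossing the crossing form is Hermitian, and its signature is read off from a
diagonalization. -/
theorem exists_crossing_diagonalization {ψ : ℝ → Matrix k k ℂ} {ψ' : Matrix k k ℂ} {t : ℝ}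
    (hψ : ∀ i j, HasDerivAt (fun s => ψ s i j) (ψ' i j) t)
    (hunit : (ψ t)ᴴ * ψ t = 1) (hskew : ψ'ᴴ * ψ t + (ψ t)ᴴ * ψ' = 0)
    (hreg : (QuadraticMap.polarBilin (crossingForm (matrixPath ψ) t)).SeparatingLeft) :
    ∃ (P G U : Matrix k k ℂ) (ev : k → ℝ), Pᴴ = P ∧ P * P = P ∧ ψ t * P = P ∧ P * ψ t = P ∧
      (∀ v : k → ℂ, ψ t *ᵥ v = v → P *ᵥ v = v) ∧ P * ψ' * P = Complex.I • G ∧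
      P * G = G ∧ G * P = G ∧ Uᴴ * U = 1 ∧
      G = U * Matrix.diagonal (fun j => (ev j : ℂ)) * Uᴴ ∧
      (∀ v : k → ℂ, G *ᵥ v = 0 → P *ᵥ v = 0) ∧
      (crossingSign (matrixPath ψ) t : ℝ) = 2 * ∑ j, Real.sign (ev j) := by
  obtain ⟨P, hPH, hPP, hψP, hPψ, hker⟩ := exists_kernel_projection hunit
  -- Differentiating `ψᴴ ψ = 1` and compressing by `P`, which absorbs `ψ t`, shows that `P ψ' P` is
  -- skew-Hermitian. So `G` is the Hermitian matrix of the crossing form, extended by zero.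
  set G : Matrix k k ℂ := (-Complex.I) • (P * ψ' * P) with hGdef
  have hIG : P * ψ' * P = Complex.I • G := by
    rw [hGdef, smul_smul]; simp
  have hskew' : P * ψ'ᴴ * P = -(P * ψ' * P) := by
    have h1 : P * (ψ'ᴴ * ψ t + (ψ t)ᴴ * ψ') * P = P * ψ'ᴴ * P + P * ψ' * P := by
      have h2 : P * (ψ t)ᴴ = P := by
        have := congrArg Matrix.conjTranspose hψP
        rwa [Matrix.conjTranspose_mul, hPH] at this
      rw [mul_add, add_mul, ← mul_assoc P (ψ t)ᴴ, h2, ← mul_assoc, mul_assoc _ (ψ t), hψP]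
    rw [hskew] at h1
    simp only [mul_zero, zero_mul] at h1
    exact eq_neg_of_add_eq_zero_left h1.symm
  have hGH : Gᴴ = G := by
    rw [hGdef, Matrix.conjTranspose_smul, Matrix.conjTranspose_mul, Matrix.conjTranspose_mul, hPH,
      ← mul_assoc, hskew']
    simp
  have hPG : P * G = G := by
    rw [hGdef, mul_smul_comm, ← mul_assoc, ← mul_assoc, hPP]
  have hGP : G * P = G := by
    rw [hGdef, smul_mul_assoc, mul_assoc, hPP]
  obtain ⟨U, ev, hU, hU', hG⟩ := exists_unitary_diagonalization hGH
  have hGU : G * U = U * Matrix.diagonal (fun j => (ev j : ℂ)) := by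
    conv_lhs => rw [hG]
    rw [mul_assoc, hU, mul_one]
  have hQ : ∀ v : crossingSpace (matrixPath ψ) t, crossingForm (matrixPath ψ) t v
      = (star (v : k → ℂ) ⬝ᵥ G *ᵥ (v : k → ℂ)).re := by
    intro v
    have hv := hker v (mem_crossingSpace.mp v.2)
    rw [crossingForm_matrixPath hψ]
    have h1 := star_dotProduct_congr P ψ' v
    rw [hv, hPH, hIG, Matrix.smul_mulVec, dotProduct_smul] at h1
    rw [← h1]
    simp
  -- If `G v = 0`, then `P v` lies in the radical of the crossing form, so regularity kills it.
  have hregG : ∀ v : k → ℂ, G *ᵥ v = 0 → P *ᵥ v = 0 := by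
    intro v hv
    have hx : P *ᵥ v ∈ crossingSpace (matrixPath ψ) t := by
      rw [mem_crossingSpace, Matrix.mulVec_mulVec, hψP]
    have hGx : G *ᵥ (P *ᵥ v) = 0 := by rw [Matrix.mulVec_mulVec, hGP, hv]
    have hxG : ∀ y : k → ℂ, star (P *ᵥ v) ⬝ᵥ G *ᵥ y = 0 := by
      intro y
      have : star (P *ᵥ v) ⬝ᵥ G *ᵥ y = star (G *ᵥ (P *ᵥ v)) ⬝ᵥ y := by
        rw [Matrix.star_mulVec G, hGH, Matrix.dotProduct_mulVec]
      rw [this, hGx]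
      simp
    have := hreg ⟨P *ᵥ v, hx⟩ (fun y => by
      rw [QuadraticMap.polarBilin_apply_apply, QuadraticMap.polar, hQ, hQ, hQ]
      simp only [Submodule.coe_add, Matrix.mulVec_add, hGx, zero_add, star_add, add_dotProduct,
        hxG, dotProduct_zero, Complex.zero_re]
      ring)
    exact congrArg Subtype.val this
  have hdiag : ∀ v : k → ℂ, (star v ⬝ᵥ G *ᵥ v).re = ∑ j, ev j *
      (((Uᴴ *ᵥ v) j).re ^ 2 + ((Uᴴ *ᵥ v) j).im ^ 2) := by
    intro v
    have h1 := star_dotProduct_congr Uᴴ (Matrix.diagonal (fun j => (ev j : ℂ))) v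
    rw [Matrix.conjTranspose_conjTranspose, ← hG] at h1
    rw [h1, dotProduct, Complex.re_sum]
    refine Finset.sum_congr rfl fun j _ => ?_
    rw [Matrix.mulVec_diagonal]
    simp
    ring
  -- A null eigenvector of `G` is killed by `P`, hence orthogonal to `v = P v`.
  have hzero : ∀ v ∈ crossingSpace (matrixPath ψ) t, ∀ j, ev j = 0 → (Uᴴ *ᵥ v) j = 0 := by
    intro v hv j hj
    have h1 : G *ᵥ (U *ᵥ Pi.single j 1) = 0 := by
      rw [Matrix.mulVec_mulVec, hGU, ← Matrix.mulVec_mulVec]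
      have : Matrix.diagonal (fun j => (ev j : ℂ)) *ᵥ Pi.single j 1 = 0 := by
        funext i
        rw [Matrix.mulVec_diagonal]
        by_cases hij : i = j
        · simp [hij, hj]
        · simp [Pi.single_eq_of_ne hij]
      rw [this, Matrix.mulVec_zero]
    have h2 := hregG _ h1
    have h3 : (Uᴴ *ᵥ v) j = star (Pi.single j (1 : ℂ)) ⬝ᵥ (Uᴴ *ᵥ v) := by
      rw [← Pi.single_star, single_dotProduct]; simp
    have h4 : star (Pi.single j (1 : ℂ)) ⬝ᵥ (Uᴴ *ᵥ v) = star (U *ᵥ Pi.single j 1) ⬝ᵥ (P *ᵥ v) := by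
      rw [hker v (mem_crossingSpace.mp hv), Matrix.dotProduct_mulVec, Matrix.star_mulVec]
    rw [h3, h4, Matrix.dotProduct_mulVec]
    have h5 : star (U *ᵥ Pi.single j (1 : ℂ)) ᵥ* P = star (P *ᵥ (U *ᵥ Pi.single j 1)) := by
      rw [Matrix.star_mulVec P, hPH]
    rw [h5, h2]
    simp
  let f : crossingSpace (matrixPath ψ) t →ₗ[ℝ] ({j // ev j ≠ 0} × Bool → ℝ) :=
    { toFun := fun v i => if i.2 then ((Uᴴ *ᵥ (v : k → ℂ)) i.1).re else ((Uᴴ *ᵥ (v : k → ℂ)) i.1).im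
      map_add' := by
        intro v v'; funext i
        simp only [Submodule.coe_add, Matrix.mulVec_add, Pi.add_apply, Complex.add_re,
          Complex.add_im]
        split_ifs <;> rfl
      map_smul' := by
        intro c v; funext i
        simp only [Submodule.coe_smul, Matrix.mulVec_smul, Pi.smul_apply, Complex.smul_re,
          Complex.smul_im, RingHom.id_apply]
        split_ifs <;> rfl }
  have hf : Function.Bijective f := by
    constructor
    · rw [injective_iff_map_eq_zero]
      intro v hv
      have h1 : Uᴴ *ᵥ (v : k → ℂ) = 0 := by
        funext j
        by_cases hj : ev j = 0
        · exact hzero v v.2 j hj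
        · have hre := congrFun hv (⟨j, hj⟩, true)
          have him := congrFun hv (⟨j, hj⟩, false)
          exact Complex.ext (by simpa [f] using hre) (by simpa [f] using him)
      have h2 : (v : k → ℂ) = U *ᵥ (Uᴴ *ᵥ (v : k → ℂ)) := by
        rw [Matrix.mulVec_mulVec, hU', Matrix.one_mulVec]
      rw [h1, Matrix.mulVec_zero] at h2
      exact Subtype.ext h2
    · intro x
      let y : k → ℂ := fun j => if hj : ev j ≠ 0 then ⟨x (⟨j, hj⟩, true), x (⟨j, hj⟩, false)⟩ else 0
      -- Since `y` vanishes at the null eigenvalues, `U y` is in the range of `G = P G`, hence fixed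
      -- by `ψ t`.
      have hy : U *ᵥ y = G *ᵥ (U *ᵥ fun j => y j / (ev j : ℂ)) := by
        rw [Matrix.mulVec_mulVec, hGU, ← Matrix.mulVec_mulVec]
        congr 1
        funext j
        rw [Matrix.mulVec_diagonal]
        by_cases hj : ev j = 0
        · simp [y, hj]
        · have : (ev j : ℂ) ≠ 0 := by exact_mod_cast hj
          field_simp
      have hmem : U *ᵥ y ∈ crossingSpace (matrixPath ψ) t := by
        rw [mem_crossingSpace, hy, Matrix.mulVec_mulVec, ← hPG, ← mul_assoc, hψP]
      refine ⟨⟨U *ᵥ y, hmem⟩, ?_⟩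
      funext ⟨⟨j, hj⟩, b⟩
      cases b <;> simp [f, y, hj, hU]
  have hequiv : QuadraticMap.Equivalent (crossingForm (matrixPath ψ) t)
      (QuadraticMap.weightedSumSquares ℝ fun i : {j // ev j ≠ 0} × Bool => ev i.1) := by
    refine ⟨⟨LinearEquiv.ofBijective f hf, fun v => ?_⟩⟩
    rw [hQ, hdiag, QuadraticMap.weightedSumSquares_apply, Fintype.sum_prod_type]
    rw [← Finset.sum_filter_add_sum_filter_not Finset.univ (fun j => ev j ≠ 0),
      Finset.sum_subtype (p := fun j => ev j ≠ 0) _ (by simp)]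
    have h0 : ∑ x with ¬ev x ≠ 0, ev x * (((Uᴴ *ᵥ (v : k → ℂ)) x).re ^ 2 +
        ((Uᴴ *ᵥ (v : k → ℂ)) x).im ^ 2) = 0 := by
      refine Finset.sum_eq_zero fun j hj => ?_
      simp only [ne_eq, not_not, Finset.mem_filter, Finset.mem_univ, true_and] at hj
      simp [hj]
    rw [h0, add_zero]
    refine Finset.sum_congr rfl fun j _ => ?_
    simp [f]
    ring
  refine ⟨P, G, U, ev, hPH, hPP, hψP, hPψ, hker, hIG, hPG, hGP, hU, hG, hregG, ?_⟩
  rw [← ncard_pos_sub_ncard_neg, crossingSign,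
    QuadraticForm.sigPos_of_equiv_weightedSumSquares hequiv,
    QuadraticForm.sigNeg_of_equiv_weightedSumSquares hequiv]
  push_cast
  rfl

end Crossing

/-! ### The Robbin–Salamon index of a loop of unitary matrices -/

section Loop

open Filter Set

variable {k : Type*} [Fintype k] [DecidableEq k]

/-- For unitary `ψ`, `(1 - ψ)ᴴ (1 - ψ)` is twice the Hermitian part of `1 - ψ`. -/
theorem one_sub_unitary_re_nonneg {ψ : Matrix k k ℂ} (hψ : ψᴴ * ψ = 1) (v : k → ℂ) :
    0 ≤ (star v ⬝ᵥ (1 - ψ) *ᵥ v).re := by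
  have h1 := star_dotProduct_congr (1 - ψ) 1 v
  have h2 : (1 - ψ)ᴴ * 1 * (1 - ψ) = (1 - ψ) + (1 - ψ)ᴴ := by
    simp only [Matrix.conjTranspose_sub, Matrix.conjTranspose_one, mul_sub, sub_mul, mul_one,
      one_mul, hψ]
    abel
  have h3 : star v ⬝ᵥ (1 - ψ)ᴴ *ᵥ v = conj (star v ⬝ᵥ (1 - ψ) *ᵥ v) := by
    rw [← Complex.star_def, ← Matrix.star_dotProduct_star, star_star, Matrix.star_mulVec,
      Matrix.dotProduct_mulVec]
  have h4 : 0 ≤ (star ((1 - ψ) *ᵥ v) ⬝ᵥ (1 : Matrix k k ℂ) *ᵥ ((1 - ψ) *ᵥ v)).re :=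
    one_mem_accretive.1 _
  rw [← h1, h2, Matrix.add_mulVec, dotProduct_add, h3, Complex.add_re, Complex.conj_re] at h4
  linarith

/-- Unitarity is known only on `[0, 1]`, so it is differentiated within that interval, where
derivatives are unique even at the ends. -/
theorem skew_of_unitary {ψ : ℝ → Matrix k k ℂ} {ψ' : Matrix k k ℂ} {t : ℝ}
    (hψ : ∀ i j, HasDerivAt (fun s => ψ s i j) (ψ' i j) t)
    (hunit : ∀ s ∈ Icc (0 : ℝ) 1, (ψ s)ᴴ * ψ s = 1) (ht : t ∈ Icc (0 : ℝ) 1) :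
    ψ'ᴴ * ψ t + (ψ t)ᴴ * ψ' = 0 := by
  ext i j
  have h1 : HasDerivAt (fun s => ((ψ s)ᴴ * ψ s) i j) ((ψ'ᴴ * ψ t + (ψ t)ᴴ * ψ') i j) t := by
    simp only [Matrix.mul_apply, Matrix.add_apply, Matrix.conjTranspose_apply,
      ← Finset.sum_add_distrib]
    exact HasDerivAt.fun_sum fun l _ => (hψ l i).star.mul (hψ l j)
  have h2 : HasDerivWithinAt (fun s => ((ψ s)ᴴ * ψ s) i j) 0 (Icc 0 1) t :=
    (hasDerivWithinAt_const t (Icc 0 1) ((1 : Matrix k k ℂ) i j)).congr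
      (fun s hs => by rw [hunit s hs]) (by rw [hunit t ht])
  exact (uniqueDiffOn_Icc zero_lt_one t ht).eq_deriv _ h1.hasDerivWithinAt h2

/-- The limit of `argDet (1 - ψ)` on the two sides of a regular crossing. -/
theorem exists_tendsto_argDet {ψ : ℝ → Matrix k k ℂ} {ψ' : Matrix k k ℂ} {t : ℝ}
    (hψ : ∀ i j, HasDerivAt (fun s => ψ s i j) (ψ' i j) t)
    (hunit : ∀ s ∈ Icc (0 : ℝ) 1, (ψ s)ᴴ * ψ s = 1) (ht : t ∈ Icc (0 : ℝ) 1)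
    (hreg : (QuadraticMap.polarBilin (crossingForm (matrixPath ψ) t)).SeparatingLeft) :
    ∃ b : ℝ, (ψ t = 1 → b = 0) ∧ ∀ σ : ℝ, σ = 1 ∨ σ = -1 →
      (∀ᶠ s in 𝓝[>] (0 : ℝ), t + σ * s ∈ Icc (0 : ℝ) 1 → 1 - ψ (t + σ * s) ∈ accretive k) ∧
      Tendsto (fun s => argDet (1 - ψ (t + σ * s)))
        (𝓝[>] (0 : ℝ) ⊓ 𝓟 {s | t + σ * s ∈ Icc (0 : ℝ) 1})
        (𝓝 (b - σ * (Real.pi / 4 * crossingSign (matrixPath ψ) t))) := by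
  obtain ⟨P, G, U, ev, hPH, hPP, hψP, hPψ, hker, hIG, hPG, hGP, hU, hG, hregG, hsig⟩ :=
    exists_crossing_diagonalization hψ (hunit t ht) (skew_of_unitary hψ hunit ht) hreg
  set Z : Matrix k k ℂ := 1 - ψ t with hZ
  have hZP : Z * P = 0 := by rw [hZ, sub_mul, hψP, one_mul, sub_self]
  have hPZ : P * Z = 0 := by rw [hZ, mul_sub, hPψ, mul_one, sub_self]
  obtain ⟨hm, hp, b, hbm, hbp, hb0⟩ := exists_argDet_eq_sign_sum (Z := Z) (G := G) (P := P)
    (fun v => one_sub_unitary_re_nonneg (hunit t ht) v) hU hG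
    (by rw [← hPG, ← mul_assoc, hZP, zero_mul]) (by rw [← hGP, mul_assoc, hPZ, mul_zero])
    (fun v hv => hker v (by
      rw [hZ, Matrix.sub_mulVec, Matrix.one_mulVec, sub_eq_zero] at hv
      exact hv.symm)) hregG
  refine ⟨b, fun h1 => hb0 (by rw [hZ, h1, sub_self]), fun σ hσ => ?_⟩
  have hσ0 : σ ≠ 0 := by rcases hσ with h | h <;> norm_num [h]
  have hlim : Z - (σ : ℂ) • (Complex.I • G) ∈ accretive k ∧
      argDet (Z - (σ : ℂ) • (Complex.I • G))
        = b - σ * (Real.pi / 4 * crossingSign (matrixPath ψ) t) := by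
    rw [hsig]
    rcases hσ with rfl | rfl
    · simp only [Complex.ofReal_one, one_smul]
      exact ⟨hm, by rw [hbm]; ring⟩
    · simp only [Complex.ofReal_neg, Complex.ofReal_one, neg_smul, one_smul, sub_neg_eq_add]
      exact ⟨hp, by rw [hbp]; ring⟩
  set M := Z - (σ : ℂ) • (Complex.I • G) with hM
  -- the difference quotient
  set R : ℝ → Matrix k k ℂ := fun s => (σ * s)⁻¹ • (ψ (t + σ * s) - ψ t) with hR
  have hR' : Tendsto R (𝓝[>] 0) (𝓝 ψ') := by
    refine tendsto_pi_nhds.mpr fun i => tendsto_pi_nhds.mpr fun j => ?_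
    have h1 := (hasDerivAt_iff_tendsto_slope_zero.mp (hψ i j))
    have h2 : Tendsto (fun s : ℝ => σ * s) (𝓝[>] 0) (𝓝[≠] 0) := by
      refine tendsto_nhdsWithin_iff.mpr ⟨?_, ?_⟩
      · have : Tendsto (fun s : ℝ => σ * s) (𝓝 0) (𝓝 (σ * 0)) :=
          (continuous_const.mul continuous_id).tendsto 0
        rw [mul_zero] at this
        exact this.mono_left nhdsWithin_le_nhds
      · filter_upwards [self_mem_nhdsWithin] with s hs
        exact mul_ne_zero hσ0 (ne_of_gt hs)
    exact h1.comp h2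
  -- On `ker (ψ t - 1)` the matrix `1 - ψ (t + σ s)` is of order `s`. Stretching by `s^{-1/2}` on
  -- both sides gives this block the limit `-σ i G`, leaves the mixed blocks of order `√s` and the
  -- remaining one near `Z`, and does not change `argDet`.
  set x : ℝ → ℝ := fun s => (Real.sqrt s)⁻¹ with hx
  set Nf : ℝ → Matrix k k ℂ := fun s => stretch P (x s) * (1 - ψ (t + σ * s)) * stretch P (x s)
    with hNf
  have hNeq : ∀ s > 0, Nf s = Z - (σ * s) • ((1 - P) * R s * (1 - P))
      - (σ * Real.sqrt s) • (P * R s * (1 - P) + (1 - P) * R s * P) - σ • (P * R s * P) := by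
    intro s hs
    have h1 : 1 - ψ (t + σ * s) = Z - (σ * s) • R s := by
      rw [hR, hZ]
      simp only
      rw [smul_smul, mul_inv_cancel₀ (mul_ne_zero hσ0 hs.ne'), one_smul]
      abel
    have hst : stretch P (x s) = (1 - P) + x s • P := by
      rw [stretch]; module
    have h2 : s * x s = Real.sqrt s := by
      rw [hx]; simp only
      have := Real.mul_self_sqrt hs.le
      have := Real.sqrt_pos.mpr hs
      field_simp
      linarith
    have h3 : s * (x s * x s) = 1 := by
      rw [← mul_assoc, h2, hx]
      exact mul_inv_cancel₀ (Real.sqrt_pos.mpr hs).ne'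
    have hZ1 : (1 - P) * Z * (1 - P) = Z := by
      simp [sub_mul, mul_sub, hPZ, hZP]
    rw [hNf]
    simp only
    rw [h1, hst, ← h2]
    have h4 : ((1 - P) + x s • P) * (Z - (σ * s) • R s) * ((1 - P) + x s • P)
        = (1 - P) * Z * (1 - P) + x s • (P * Z * (1 - P)) + x s • ((1 - P) * (Z * P))
          + (x s * x s) • (P * Z * P) - (σ * s) • ((1 - P) * R s * (1 - P))
          - (σ * (s * x s)) • (P * R s * (1 - P) + (1 - P) * R s * P)
          - (σ * (s * (x s * x s))) • (P * R s * P) := by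
      simp only [add_mul, mul_add, mul_sub, sub_mul, smul_mul_assoc, mul_smul_comm, one_mul,
        mul_one, mul_assoc, smul_sub, smul_add]
      module
    rw [h4, hZ1, hPZ, hZP, h3]
    simp
  have hNlim : Tendsto Nf (𝓝[>] 0) (𝓝 M) := by
    have hs0 : Tendsto (fun s : ℝ => σ * s) (𝓝[>] 0) (𝓝 0) := by
      have : Tendsto (fun s : ℝ => σ * s) (𝓝 0) (𝓝 (σ * 0)) :=
        (continuous_const.mul continuous_id).tendsto 0
      rw [mul_zero] at this
      exact this.mono_left nhdsWithin_le_nhds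
    have hs1 : Tendsto (fun s : ℝ => σ * Real.sqrt s) (𝓝[>] 0) (𝓝 0) := by
      have : Tendsto (fun s : ℝ => σ * Real.sqrt s) (𝓝 0) (𝓝 (σ * Real.sqrt 0)) :=
        (continuous_const.mul Real.continuous_sqrt).tendsto 0
      rw [Real.sqrt_zero, mul_zero] at this
      exact this.mono_left nhdsWithin_le_nhds
    have hmul : ∀ A B : Matrix k k ℂ, Tendsto (fun s => A * R s * B) (𝓝[>] 0) (𝓝 (A * ψ' * B)) :=
      fun A B => ((continuous_const.matrix_mul continuous_id).matrix_mul
        continuous_const |>.tendsto ψ').comp hR'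
    have h1 := ((tendsto_const_nhds (x := Z)).sub (hs0.smul (hmul (1 - P) (1 - P)))).sub
      (hs1.smul ((hmul P (1 - P)).add (hmul (1 - P) P))) |>.sub
      ((tendsto_const_nhds (x := σ)).smul (hmul P P))
    rw [zero_smul, zero_smul, sub_zero, sub_zero, hIG] at h1
    have h2 : Z - σ • Complex.I • G = M := rfl
    rw [h2] at h1
    refine h1.congr' ?_
    filter_upwards [self_mem_nhdsWithin] with s hs
    exact (hNeq s hs).symm
  have hdet : ∀ᶠ s in 𝓝[>] 0, (Nf s).det ≠ 0 :=
    ((Continuous.matrix_det continuous_id).tendsto M |>.comp hNlim).eventually_ne hlim.1.2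
  have hxpos : ∀ s > 0, 0 < x s := fun s hs => inv_pos.mpr (Real.sqrt_pos.mpr hs)
  have hmem : ∀ᶠ s in 𝓝[>] 0, t + σ * s ∈ Icc (0 : ℝ) 1 → 1 - ψ (t + σ * s) ∈ accretive k := by
    filter_upwards [hdet] with s hs hsI
    refine ⟨one_sub_unitary_re_nonneg (hunit _ hsI), fun h0 => hs ?_⟩
    rw [hNf]
    simp [Matrix.det_mul, h0]
  refine ⟨hmem, ?_⟩
  -- The principal filter keeps `t + σ s` in the interval, where `ψ` is unitary; at an endpoint of
  -- `[0, 1]` the outward side is vacuous.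
  have hmemN : ∀ᶠ s in 𝓝[>] (0 : ℝ) ⊓ 𝓟 {s | t + σ * s ∈ Icc (0 : ℝ) 1},
      Nf s ∈ accretive k ∧ argDet (Nf s) = argDet (1 - ψ (t + σ * s)) := by
    rw [eventually_inf_principal]
    filter_upwards [hmem, self_mem_nhdsWithin] with s hs hs0 hsI
    have h1 := congr_mem_accretive (hs hsI) (det_stretch_ne_zero hPP (hxpos s hs0))
    rw [conjTranspose_stretch hPH] at h1
    exact ⟨h1, argDet_stretch hPP hPH (hxpos s hs0) (hs hsI)⟩
  have h1 : Tendsto Nf (𝓝[>] (0 : ℝ) ⊓ 𝓟 {s | t + σ * s ∈ Icc (0 : ℝ) 1})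
      (𝓝[accretive k] M) :=
    tendsto_nhdsWithin_iff.mpr ⟨hNlim.mono_left inf_le_left, hmemN.mono fun s hs => hs.1⟩
  have h2 := (continuousOn_argDet M hlim.1).tendsto.comp h1
  rw [hlim.2] at h2
  exact h2.congr' (hmemN.mono fun s hs => hs.2)

/-- By `1 - ψ = -ψ (1 - ψ)ᴴ`, an argument `α` of `det (1 - ψ)` satisfies `α = kπ + θ - α` modulo
`2π`, with `k` the size of the matrix. -/
theorem isArg_det_one_sub {ψ : Matrix k k ℂ} (hψ : ψᴴ * ψ = 1) (hmem : 1 - ψ ∈ accretive k)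
    {θ : ℝ} (hθ : ψ.det = Complex.exp (θ * Complex.I)) :
    ∃ n : ℤ, 2 * argDet (1 - ψ) - θ = Fintype.card k * Real.pi + n * (2 * Real.pi) := by
  have hψ' : ψ * ψᴴ = 1 := mul_eq_one_comm.mp hψ
  have h1 : (1 - ψ).det = (-1) ^ Fintype.card k * ψ.det * conj (1 - ψ).det := by
    have : 1 - ψ = (-1 : ℂ) • (ψ * (1 - ψ)ᴴ) := by
      simp [mul_sub, hψ']
    conv_lhs => rw [this]
    rw [Matrix.det_smul, Matrix.det_mul, Matrix.det_conjTranspose, mul_assoc]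
    rfl
  have h2 := isArg_argDet hmem
  have h3 : IsArg ((-1 : ℂ) ^ Fintype.card k) (Fintype.card k * Real.pi) := by
    have := isArg_exp (Fintype.card k * Real.pi)
    have h4 : Complex.exp (((Fintype.card k * Real.pi : ℝ) : ℂ) * Complex.I)
        = (-1) ^ Fintype.card k := by
      rw [← Complex.exp_pi_mul_I, ← Complex.exp_nat_mul]
      push_cast; ring_nf
    rwa [h4] at this
  have h4 : IsArg (1 - ψ).det (Fintype.card k * Real.pi + θ + -argDet (1 - ψ)) := by
    have := (h3.mul (hθ ▸ isArg_exp θ)).mul h2.conj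
    rwa [← h1] at this
  obtain ⟨n, hn⟩ := h2.sub_mem h4 hmem.2
  exact ⟨n, by linarith⟩

/-- The Robbin–Salamon index of a loop of unitary matrices is twice the winding number of the
determinant. -/
theorem robbinSalamon_loop {ψ ψ' : ℝ → Matrix k k ℂ} {θ : ℝ → ℝ}
    (hψ : ∀ t ∈ Icc (0 : ℝ) 1, ∀ i j, HasDerivAt (fun s => ψ s i j) (ψ' t i j) t)
    (hunit : ∀ s ∈ Icc (0 : ℝ) 1, (ψ s)ᴴ * ψ s = 1) (h0 : ψ 0 = 1) (h1 : ψ 1 = 1)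
    (hreg : RegularCrossings (matrixPath ψ) 1) (hθ : ContinuousOn θ (Icc 0 1))
    (hdet : ∀ t ∈ Icc (0 : ℝ) 1, (ψ t).det = Complex.exp (θ t * Complex.I)) :
    robbinSalamon (matrixPath ψ) 1 = (θ 1 - θ 0) / Real.pi := by
  -- Stated for all real `t` only so that `choose` yields a function; outside `[0, 1]` the value of
  -- `b` is irrelevant.
  have hex : ∀ t : ℝ, ∃ b : ℝ, t ∈ Icc (0 : ℝ) 1 → (ψ t = 1 → b = 0) ∧
      ∀ σ : ℝ, σ = 1 ∨ σ = -1 → ∀ᶠ s in 𝓝[>] (0 : ℝ), t + σ * s ∈ Icc (0 : ℝ) 1 →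
        2 * argDet (1 - ψ (t + σ * s)) - θ (t + σ * s)
          = 2 * b - θ t - σ * (Real.pi / 2 * crossingSign (matrixPath ψ) t) := by
    intro t
    by_cases ht : t ∈ Icc (0 : ℝ) 1
    swap
    · exact ⟨0, fun h => (ht h).elim⟩
    obtain ⟨b, hb, hlim⟩ := exists_tendsto_argDet (hψ t ht) hunit ht (hreg t ht)
    refine ⟨b, fun _ => ⟨hb, fun σ hσ => ?_⟩⟩
    obtain ⟨hmem, hlim⟩ := hlim σ hσ
    have hθlim : Tendsto (fun s => θ (t + σ * s))
        (𝓝[>] (0 : ℝ) ⊓ 𝓟 {s | t + σ * s ∈ Icc (0 : ℝ) 1}) (𝓝 (θ t)) := by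
      refine (hθ t ht).tendsto.comp (tendsto_nhdsWithin_iff.mpr ⟨?_, ?_⟩)
      · have : Tendsto (fun s : ℝ => t + σ * s) (𝓝 0) (𝓝 (t + σ * 0)) :=
          (by fun_prop : Continuous fun s : ℝ => t + σ * s).tendsto 0
        rw [mul_zero, add_zero] at this
        exact this.mono_left (inf_le_left.trans nhdsWithin_le_nhds)
      · exact mem_inf_of_right (mem_principal_self _)
    have := eventually_eq_of_tendsto_of_mem_zmultiples (c := 2 * Real.pi)
      (d := Fintype.card k * Real.pi) (by positivity)
      ((hlim.const_mul 2).sub hθlim) (by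
        rw [eventually_inf_principal]
        filter_upwards [hmem] with s hs hsI
        exact isArg_det_one_sub (hunit _ hsI) (hs hsI) (hdet _ hsI))
    rw [eventually_inf_principal] at this
    filter_upwards [this] with s hs hsI
    rw [hs hsI]
    ring
  choose b hb using hex
  have key := sum_of_jumps (g := fun t => 2 * argDet (1 - ψ t) - θ t)
    (B := fun t => 2 * b t - θ t) (c := fun t => Real.pi / 2 * crossingSign (matrixPath ψ) t)
    (fun t ht => by
      have h := (hb t ⟨ht.1, ht.2.le⟩).2 1 (Or.inl rfl)
      have hmap : Tendsto (fun s => s - t) (𝓝[>] t) (𝓝[>] 0) := by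
        refine tendsto_nhdsWithin_iff.mpr ⟨?_, ?_⟩
        · have : Tendsto (fun s => s - t) (𝓝 t) (𝓝 (t - t)) :=
            (continuous_id.sub continuous_const).tendsto t
          rw [sub_self] at this
          exact this.mono_left nhdsWithin_le_nhds
        · filter_upwards [self_mem_nhdsWithin] with s (hs : t < s)
          exact sub_pos.mpr hs
      filter_upwards [hmap.eventually h, Ioo_mem_nhdsGT ht.2] with s hs hs'
      have e : t + 1 * (s - t) = s := by ring
      rw [e] at hs
      rw [hs ⟨ht.1.trans hs'.1.le, hs'.2.le⟩]
      ring)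
    (fun t ht => by
      have h := (hb t ⟨ht.1.le, ht.2⟩).2 (-1) (Or.inr rfl)
      have hmap : Tendsto (fun s => t - s) (𝓝[<] t) (𝓝[>] 0) := by
        refine tendsto_nhdsWithin_iff.mpr ⟨?_, ?_⟩
        · have : Tendsto (fun s => t - s) (𝓝 t) (𝓝 (t - t)) :=
            (continuous_const.sub continuous_id).tendsto t
          rw [sub_self] at this
          exact this.mono_left nhdsWithin_le_nhds
        · filter_upwards [self_mem_nhdsWithin] with s (hs : s < t)
          exact sub_pos.mpr hs
      filter_upwards [hmap.eventually h, Ioo_mem_nhdsLT ht.1] with s hs hs'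
      have e : t + -1 * (t - s) = s := by ring
      rw [e] at hs
      rw [hs ⟨hs'.1.le, hs'.2.le.trans ht.2⟩]
      ring)
  -- The loop condition enters here: at both ends `ψ = 1`, so the midpoint `2 b - θ` is just `-θ`.
  have hb0 := (hb 0 ⟨le_rfl, zero_le_one⟩).1 h0
  have hb1 := (hb 1 ⟨zero_le_one, le_rfl⟩).1 h1
  simp only [hb0, hb1] at key
  -- `smul_finsum` applies without finite support.
  have hsum : ∑ᶠ t ∈ Ioo (0 : ℝ) 1, Real.pi / 2 * (crossingSign (matrixPath ψ) t : ℝ)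
      = Real.pi / 2 * ∑ᶠ t ∈ Ioo (0 : ℝ) 1, (crossingSign (matrixPath ψ) t : ℝ) := by
    have h := smul_finsum (Real.pi / 2)
      (fun t => ∑ᶠ _ : t ∈ Ioo (0 : ℝ) 1, (crossingSign (matrixPath ψ) t : ℝ))
    simp only [smul_eq_mul] at h
    rw [h]
    refine finsum_congr fun t => ?_
    have h' := smul_finsum (Real.pi / 2)
      (fun _ : t ∈ Ioo (0 : ℝ) 1 => (crossingSign (matrixPath ψ) t : ℝ))
    simp only [smul_eq_mul] at h'
    rw [h']
  rw [hsum] at key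
  rw [robbinSalamon, eq_div_iff Real.pi_pos.ne']
  linarith

end Loop

/-! ### Non-degenerate weighted homogeneous polynomials -/

section Polynomials

open MvPolynomial

variable {m : ℕ} {W : MvPolynomial (Fin (m + 1)) ℂ} {w : Fin (m + 1) → ℕ} {h : ℕ}

theorem eval_weighted_scale {σ : Type*} [Fintype σ] {φ : MvPolynomial σ ℂ} {w : σ → ℕ} {n : ℕ}
    (hφ : IsWeightedHomogeneous w φ n) (s : ℂ) (z : σ → ℂ) :
    eval (fun i => s ^ w i * z i) φ = s ^ n * eval z φ := by
  rw [eval_eq', eval_eq', Finset.mul_sum]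
  refine Finset.sum_congr rfl fun d hd => ?_
  have hwd := hφ (mem_support_iff.mp hd)
  rw [Finsupp.weight_apply, Finsupp.sum_fintype _ _ (by simp)] at hwd
  have h1 : ∏ i, (s ^ w i * z i) ^ d i = s ^ n * ∏ i, z i ^ d i := by
    simp only [mul_pow, Finset.prod_mul_distrib, ← pow_mul, Finset.prod_pow_eq_pow_sum]
    rw [← hwd]
    simp [mul_comm]
  rw [h1]; ring

/-- Only pure powers of the `i`-th variable survive on the `i`-th axis. -/
theorem eval_single_eq_zero {σ : Type*} [Fintype σ] [DecidableEq σ] {φ : MvPolynomial σ ℂ} {i : σ}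
    (hφ : ∀ a, coeff (Finsupp.single i a) φ = 0) (s : ℂ) : eval (Pi.single i s) φ = 0 := by
  rw [eval_eq']
  refine Finset.sum_eq_zero fun d hd => ?_
  have h1 : d ≠ Finsupp.single i (d i) := by
    intro h1
    rw [mem_support_iff, h1] at hd
    exact hd (hφ _)
  obtain ⟨j, hj⟩ : ∃ j, d j ≠ Finsupp.single i (d i) j := by
    by_contra! hcon
    exact h1 (Finsupp.ext hcon)
  have hji : j ≠ i := by
    rintro rfl
    simp at hj
  rw [Finsupp.single_eq_of_ne hji] at hj
  rw [Finset.prod_eq_zero (Finset.mem_univ j), mul_zero]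
  rw [Pi.single_eq_of_ne hji, zero_pow hj]

/-- Every variable occurs in a monomial `z_i^a z_j` with exponent of `z_i` at least two. -/
theorem IsNondegenerate.exists_monomial (hW : IsNondegenerate W w h) (i : Fin (m + 1)) :
    ∃ (a : ℕ) (j : Fin (m + 1)), coeff (Finsupp.single i a + Finsupp.single j 1) W ≠ 0 ∧
      2 ≤ (Finsupp.single i a + Finsupp.single j 1 : Fin (m + 1) →₀ ℕ) i := by
  by_contra! hcon
  have hcoeff : ∀ j a, coeff (Finsupp.single i a + Finsupp.single j 1) W = 0 := by
    intro j a
    by_contra hne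
    have h1 := hcon a j hne
    have h2 : a ≤ 1 := by
      simp only [Finsupp.add_apply, Finsupp.single_eq_same] at h1
      omega
    -- For `a = 0` the monomial is linear and excluded by criticality of the origin; for `a = 1` it
    -- is a forbidden mixed quadratic term, or a square, which has exponent two.
    interval_cases a
    · have hcrit := hW.critical j
      rw [eval_zero, constantCoeff_eq, coeff_pderiv] at hcrit
      apply hne
      simpa using hcrit
    · by_cases hij : i = j
      · subst hij
        simp at h1
      · exact hne (hW.no_mixed_quadratic i j hij)
  have hzero : ∀ s : ℂ, ∀ j, eval (Pi.single i s) (pderiv j W) = 0 := by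
    intro s j
    refine eval_single_eq_zero (fun a => ?_) s
    rw [coeff_pderiv, hcoeff, zero_mul]
  have htend : Filter.Tendsto (fun s : ℂ => (Pi.single i s : Fin (m + 1) → ℂ)) (𝓝[≠] 0)
      (𝓝[≠] 0) := by
    refine tendsto_nhdsWithin_iff.mpr ⟨?_, ?_⟩
    · have : Filter.Tendsto (fun s : ℂ => (Pi.single i s : Fin (m + 1) → ℂ)) (𝓝 0)
          (𝓝 (Pi.single i 0)) := (continuous_single i).tendsto 0
      rw [Pi.single_zero] at this
      exact this.mono_left nhdsWithin_le_nhds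
    · filter_upwards [self_mem_nhdsWithin] with s hs
      simpa using hs
  obtain ⟨s, j, hj⟩ := (htend.eventually hW.isolated).exists
  exact hj (hzero s j)

/-- The monomial of `exists_monomial` has weight `h`, and this is at least `2 * w i`. -/
theorem IsNondegenerate.weight_lt (hW : IsNondegenerate W w h) (i : Fin (m + 1)) : w i < h := by
  obtain ⟨a, j, hne, h2⟩ := hW.exists_monomial i
  have hwd := hW.homogeneous hne
  have hi := hW.w_pos i
  have hj := hW.w_pos j
  rw [map_add, Finsupp.weight_single, Finsupp.weight_single, smul_eq_mul, one_smul] at hwd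
  by_cases hij : i = j
  · subst hij
    simp only [Finsupp.add_apply, Finsupp.single_eq_same] at h2
    have : 1 ≤ a := by omega
    nlinarith
  · rw [Finsupp.add_apply, Finsupp.single_eq_same, Finsupp.single_eq_of_ne hij] at h2
    nlinarith

/-- The derivative has weight `h - w k`; the factor `s ^ w k` avoids the subtraction. -/
theorem IsNondegenerate.eval_pderiv_scale (hW : IsNondegenerate W w h) (k : Fin (m + 1)) (s : ℂ)
    (z : Fin (m + 1) → ℂ) :
    eval (fun i => s ^ w i * z i) (pderiv k W) * s ^ w k = s ^ h * eval z (pderiv k W) := by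
  have h1 : h - w k + w k = h := Nat.sub_add_cancel (hW.weight_lt k).le
  rw [eval_weighted_scale (hW.homogeneous.pderiv h1), mul_right_comm, ← pow_add, h1]

/-- The origin is the only critical point. -/
theorem IsNondegenerate.exists_pderiv_ne_zero (hW : IsNondegenerate W w h) {p : Fin (m + 1) → ℂ}
    (hp : p ≠ 0) : ∃ i, eval p (pderiv i W) ≠ 0 := by
  by_contra! hcon
  obtain ⟨i, hi⟩ := Function.ne_iff.mp hp
  -- Weighted scaling would carry a critical point `p ≠ 0` through critical points into the origin,
  -- contradicting isolatedness.
  have htend : Filter.Tendsto (fun s : ℂ => (fun j => s ^ w j * p j : Fin (m + 1) → ℂ)) (𝓝[≠] 0)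
      (𝓝[≠] 0) := by
    refine tendsto_nhdsWithin_iff.mpr ⟨?_, ?_⟩
    · have h1 : Continuous (fun s : ℂ => (fun j => s ^ w j * p j : Fin (m + 1) → ℂ)) := by
        fun_prop
      have h2 := h1.tendsto 0
      have h3 : (fun j => (0 : ℂ) ^ w j * p j : Fin (m + 1) → ℂ) = 0 := by
        funext j
        simp [(hW.w_pos j).ne']
      rw [h3] at h2
      exact h2.mono_left nhdsWithin_le_nhds
    · filter_upwards [self_mem_nhdsWithin] with s hs h0
      have := congrFun h0 i
      simp only [Pi.zero_apply, mul_eq_zero] at this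
      rcases this with h | h
      · exact hs (pow_eq_zero_iff (hW.w_pos i).ne' |>.mp h)
      · exact hi h
  obtain ⟨s, ⟨j, hj⟩, hs⟩ := ((htend.eventually hW.isolated).and self_mem_nhdsWithin).exists
  have := hW.eval_pderiv_scale j s p
  rw [hcon, mul_zero] at this
  exact (mul_ne_zero hj (pow_ne_zero _ hs)) this

/-- The functions `W (g • x)` and `W x` agree, hence so do the coefficients at each monomial. -/
theorem prod_pow_eq_one_of_mem_diagonalSymmetry {g : Fin (m + 1) → ℂˣ}
    (hg : g ∈ diagonalSymmetry W) {d : Fin (m + 1) →₀ ℕ} (hd : coeff d W ≠ 0) :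
    ∏ i, g i ^ d i = 1 := by
  have h1 : ∑ e ∈ W.support, monomial e (coeff e W * ∏ i, (g i : ℂ) ^ e i) = W := by
    refine MvPolynomial.funext fun x => ?_
    rw [← hg x, map_sum, eval_eq' (g • x)]
    refine Finset.sum_congr rfl fun e _ => ?_
    rw [eval_monomial, Finsupp.prod_fintype _ _ (by simp), mul_assoc, ← Finset.prod_mul_distrib]
    congr 1
    refine Finset.prod_congr rfl fun i _ => ?_
    rw [← mul_pow]
    rfl
  have h2 := congrArg (coeff d) h1
  rw [coeff_sum] at h2
  simp only [coeff_monomial] at h2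
  rw [Finset.sum_ite_eq' W.support d, if_pos (mem_support_iff.mpr hd)] at h2
  have h3 : ∏ i, (g i : ℂ) ^ d i = 1 := mul_left_cancel₀ hd (h2.trans (mul_one _).symm)
  apply Units.ext
  push_cast
  exact h3

theorem zpow_sum {G ι : Type*} [CommGroup G] (g : G) (s : Finset ι) (f : ι → ℤ) :
    g ^ (∑ i ∈ s, f i) = ∏ i ∈ s, g ^ f i := by
  classical
  induction s using Finset.induction_on with
  | empty => simp
  | insert a s ha ih => rw [Finset.sum_insert ha, Finset.prod_insert ha, zpow_add, ih]

/-- The group of diagonal symmetries of a non-degenerate polynomial is finite. -/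
theorem IsNondegenerate.finite_diagonalSymmetry (hW : IsNondegenerate W w h) :
    Finite (diagonalSymmetry W) := by
  choose a j hne h2 using hW.exists_monomial
  set e : Fin (m + 1) → Fin (m + 1) →₀ ℕ := fun i => Finsupp.single i (a i) + Finsupp.single (j i) 1
    with he
  -- The chosen exponent vectors are strictly diagonally dominant rows: at least `2` on the
  -- diagonal, total at most `1` off it.
  set A : Matrix (Fin (m + 1)) (Fin (m + 1)) ℤ := Matrix.of fun i l => (e i l : ℤ) with hA
  have hdetR : (A.map (Int.castRingHom ℝ)).det ≠ 0 := by
    refine det_ne_zero_of_sum_row_lt_diag fun i => ?_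
    have h3 : ∀ l, ‖(A.map (Int.castRingHom ℝ)) i l‖ = (e i l : ℝ) := by
      intro l
      simp [hA]
    simp only [h3]
    have h4 : ∑ l ∈ Finset.univ.erase i, (e i l : ℝ) ≤ 1 := by
      calc ∑ l ∈ Finset.univ.erase i, (e i l : ℝ)
          = ∑ l ∈ Finset.univ.erase i, ((Finsupp.single (j i) 1 : Fin (m + 1) →₀ ℕ) l : ℝ) := by
            refine Finset.sum_congr rfl fun l hl => ?_
            rw [he]
            simp [Finsupp.single_eq_of_ne (Finset.ne_of_mem_erase hl)]
        _ ≤ ∑ l, ((Finsupp.single (j i) 1 : Fin (m + 1) →₀ ℕ) l : ℝ) :=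
            Finset.sum_le_sum_of_subset_of_nonneg (Finset.erase_subset _ _)
              fun _ _ _ => Nat.cast_nonneg _
        _ = 1 := by
            simp [Finsupp.single_apply]
    have h5 : (2 : ℝ) ≤ (e i i : ℝ) := by exact_mod_cast h2 i
    linarith
  have hdet : A.det ≠ 0 := by
    intro h0
    apply hdetR
    have := RingHom.map_det (Int.castRingHom ℝ) A
    rw [h0, map_zero] at this
    exact this.symm
  have hD : A.det.natAbs ≠ 0 := Int.natAbs_ne_zero.mpr hdet
  -- Multiplying the relations `∏ r, g r ^ A i r = 1` with adjugate exponents isolates `g l ^ det A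
  -- = 1`, so the group sits in a finite product of groups of roots of unity.
  have hpow : ∀ g ∈ diagonalSymmetry W, ∀ l, g l ^ A.det.natAbs = 1 := by
    intro g hg l
    have h3 : ∀ i, ∏ r, g r ^ (A i r) = 1 := by
      intro i
      have := prod_pow_eq_one_of_mem_diagonalSymmetry hg (hne i)
      simp only [hA, Matrix.of_apply, zpow_natCast]
      exact this
    have h4 : ∏ i, (∏ r, g r ^ (A i r)) ^ (A.adjugate l i) = ∏ r, g r ^ ((A.adjugate * A) l r) := by
      simp only [← Finset.prod_zpow, ← zpow_mul]
      rw [Finset.prod_comm]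
      refine Finset.prod_congr rfl fun r _ => ?_
      rw [Matrix.mul_apply, zpow_sum]
      refine Finset.prod_congr rfl fun i _ => ?_
      rw [mul_comm]
    have h5 : ∏ r, g r ^ ((A.adjugate * A) l r) = g l ^ A.det := by
      rw [Matrix.adjugate_mul, Finset.prod_eq_single l]
      · simp
      · intro r _ hr
        simp [Matrix.one_apply_ne hr.symm]
      · simp
    have h6 : g l ^ A.det = 1 := by
      rw [← h5, ← h4]
      simp [h3]
    rcases Int.natAbs_eq A.det with h7 | h7
    · rw [h7, zpow_natCast] at h6
      exact h6
    · rw [h7, zpow_neg, zpow_natCast, inv_eq_one] at h6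
      exact h6
  have : NeZero A.det.natAbs := ⟨hD⟩
  have hfin : (Set.univ.pi fun _ : Fin (m + 1) =>
      ((rootsOfUnity A.det.natAbs ℂ : Subgroup ℂˣ) : Set ℂˣ)).Finite :=
    Set.Finite.pi fun _ => @Set.toFinite _ _
      (inferInstanceAs (Finite (rootsOfUnity A.det.natAbs ℂ)))
  refine (hfin.subset fun g hg => ?_).to_subtype
  intro l _
  exact (mem_rootsOfUnity _ _).mpr (hpow g hg l)

/-- Restrict `W` to the line `x e_i + e_j`. Either this polynomial in `x` has a root, or it is a
constant `c`; then homogeneity gives `W (e_i + s^{w_j} e_j) = s^h c` for `s ≠ 0`, and `s → 0` gives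
`W (e_i) = 0`. -/
theorem exists_nonzero_zero (hm : 1 ≤ m) (hW : IsNondegenerate W w h) :
    ∃ z : Fin (m + 1) → ℂ, z ≠ 0 ∧ eval z W = 0 := by
  obtain ⟨i, j, hij⟩ : ∃ i j : Fin (m + 1), i ≠ j := by
    refine ⟨0, Fin.last m, ?_⟩
    intro h0
    have := congrArg Fin.val h0
    simp at this
    omega
  set q : Polynomial ℂ := aeval (fun l => if l = i then Polynomial.X else
    if l = j then (1 : Polynomial ℂ) else 0) W with hq
  have hqe : ∀ x, q.eval x = eval (fun l => if l = i then x else if l = j then 1 else 0) W := by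
    intro x
    have := MvPolynomial.comp_aeval_apply (fun l => if l = i then Polynomial.X else
      if l = j then (1 : Polynomial ℂ) else 0) (Polynomial.aeval x) W
    rw [Polynomial.coe_aeval_eq_eval] at this
    rw [hq, this, ← MvPolynomial.aeval_eq_eval]
    congr 2
    funext l
    split_ifs <;> simp
  by_cases hroot : ∃ x, q.eval x = 0
  · obtain ⟨x, hx⟩ := hroot
    refine ⟨_, ?_, (hqe x).symm.trans hx⟩
    intro h0
    have := congrFun h0 j
    simp [hij.symm] at this
  · have hdeg : q.degree ≤ 0 := by
      by_contra hcon
      exact hroot (IsAlgClosed.exists_root q (fun h0 => hcon h0.le))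
    have hconst : ∀ x, q.eval x = q.coeff 0 := by
      intro x
      rw [Polynomial.eq_C_of_degree_le_zero hdeg]
      simp
    have hscale : ∀ s : ℂ, s ≠ 0 →
        eval (fun l => if l = i then 1 else if l = j then s ^ w j else 0) W
          = s ^ h * q.coeff 0 := by
      intro s hs
      have h1 := eval_weighted_scale hW.homogeneous s
        (fun l => if l = i then (s ^ w i)⁻¹ else if l = j then 1 else 0)
      rw [← hqe, hconst] at h1
      rw [← h1]
      congr 2
      funext l
      by_cases hl : l = i
      · subst hl
        simp [hs]
      · by_cases hl' : l = j
        · subst hl'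
          simp [hl]
        · simp [hl, hl']
    have h1 : Continuous fun s : ℂ =>
        eval (fun l => if l = i then 1 else if l = j then s ^ w j else 0) W := by
      refine (MvPolynomial.continuous_eval W).comp (continuous_pi fun l => ?_)
      split_ifs <;> fun_prop
    have h2 : Continuous fun s : ℂ => s ^ h * q.coeff 0 := by fun_prop
    have h3 := tendsto_nhds_unique_of_eventuallyEq (f := fun s : ℂ =>
        eval (fun l => if l = i then 1 else if l = j then s ^ w j else 0) W)
      (g := fun s : ℂ => s ^ h * q.coeff 0) (l := 𝓝[≠] 0)
      ((h1.tendsto 0).mono_left nhdsWithin_le_nhds) ((h2.tendsto 0).mono_left nhdsWithin_le_nhds)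
      (by filter_upwards [self_mem_nhdsWithin] with s hs using hscale s hs)
    refine ⟨_, ?_, h3.trans (by simp [hW.h_pos.ne'])⟩
    intro h0
    have := congrFun h0 i
    simp at this

/-- Weighted real scaling of a nonzero zero stays in `W⁻¹(0)`, and its norm passes through `δ` by
the intermediate value theorem. -/
theorem IsNondegenerate.link_nonempty (hm : 1 ≤ m) (hW : IsNondegenerate W w h) {δ : ℝ}
    (hδ : 0 < δ) : (link W δ).Nonempty := by
  obtain ⟨z, hz, hz0⟩ := exists_nonzero_zero hm hW
  obtain ⟨i, hi⟩ := Function.ne_iff.mp hz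
  have hi' : 0 < ‖z i‖ := norm_pos_iff.mpr hi
  set N : ℝ → ℝ := fun r => ∑ l, ‖(r : ℂ) ^ w l * z l‖ ^ 2 with hN
  have hcont : Continuous N := by fun_prop
  have hN0 : N 0 = 0 := by
    simp only [hN]
    refine Finset.sum_eq_zero fun l _ => ?_
    simp [(hW.w_pos l).ne']
  -- `R ≥ 1` ensures `R ^ w i ≥ R`, and `R ≥ δ / ‖z i‖` then makes the `i`-th coordinate alone large
  -- enough.
  set R : ℝ := max 1 (δ / ‖z i‖) with hR
  have hR1 : 1 ≤ R := le_max_left _ _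
  have hNR : δ ^ 2 ≤ N R := by
    calc δ ^ 2 ≤ ‖(R : ℂ) ^ w i * z i‖ ^ 2 := by
          refine pow_le_pow_left₀ hδ.le ?_ 2
          rw [norm_mul, norm_pow, Complex.norm_real, Real.norm_of_nonneg (by linarith)]
          have h1 : R ≤ R ^ w i := le_self_pow₀ hR1 (hW.w_pos i).ne'
          have h2 : δ / ‖z i‖ ≤ R := le_max_right _ _
          rw [div_le_iff₀ hi'] at h2
          nlinarith
      _ ≤ N R := Finset.single_le_sum (f := fun l => ‖(R : ℂ) ^ w l * z l‖ ^ 2)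
          (fun _ _ => by positivity) (Finset.mem_univ i)
  obtain ⟨r, _, hr⟩ := intermediate_value_Icc (show (0 : ℝ) ≤ R by linarith) hcont.continuousOn
    (show δ ^ 2 ∈ Set.Icc (N 0) (N R) from ⟨by rw [hN0]; positivity, hNR⟩)
  refine ⟨fun l => (r : ℂ) ^ w l * z l, ?_, hr⟩
  rw [eval_weighted_scale hW.homogeneous, hz0, mul_zero]

theorem ne_zero_of_mem_link {δ : ℝ} (hδ : 0 < δ) {p : Fin (m + 1) → ℂ} (hp : p ∈ link W δ) :
    p ≠ 0 := by
  rintro rfl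
  have := hp.2
  simp only [Pi.zero_apply, norm_zero] at this
  simp at this
  exact hδ.ne' (by nlinarith)

end Polynomials

/-! ### The volume form along the flow -/

section VolumeForm

variable {m : ℕ} {W : MvPolynomial (Fin (m + 1)) ℂ} {w : Fin (m + 1) → ℕ} {h : ℕ}

/-- The flow is weighted scaling by the single number `exp (2πi t / h)`, so homogeneity of `W`
applies to it. -/
theorem flow_apply (w : Fin (m + 1) → ℕ) (h : ℕ) (t : ℝ) (i : Fin (m + 1)) :
    ((flow w h t i : ℂˣ) : ℂ) = Complex.exp (2 * Real.pi * Complex.I * t / h) ^ w i := by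
  simp only [flow, Units.val_mk0, ← Complex.exp_nat_mul]
  congr 1
  ring

theorem flow_smul_apply (w : Fin (m + 1) → ℕ) (h : ℕ) (t : ℝ) (v : Fin (m + 1) → ℂ)
    (i : Fin (m + 1)) : (flow w h t • v) i = ((flow w h t i : ℂˣ) : ℂ) * v i := rfl

theorem flow_zero (w : Fin (m + 1) → ℕ) (h : ℕ) : flow w h 0 = 1 := by
  funext i
  apply Units.ext
  simp [flow]

theorem conj_flow_mul_flow (w : Fin (m + 1) → ℕ) (h : ℕ) (t : ℝ) (i : Fin (m + 1)) :
    conj ((flow w h t i : ℂˣ) : ℂ) * ((flow w h t i : ℂˣ) : ℂ) = 1 := by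
  have h1 : ((flow w h t i : ℂˣ) : ℂ)
      = Complex.exp ((2 * Real.pi * (w i / h) * t : ℝ) * Complex.I) := by
    simp only [flow, Units.val_mk0]
    congr 1
    push_cast
    ring
  rw [Complex.conj_mul', h1, Complex.norm_exp_ofReal_mul_I]
  simp

theorem IsNondegenerate.exp_pow (hW : IsNondegenerate W w h) (t : ℝ) :
    Complex.exp (2 * Real.pi * Complex.I * t / h) ^ h = Complex.exp (2 * Real.pi * Complex.I * t) := by
  have hh : (h : ℂ) ≠ 0 := by exact_mod_cast hW.h_pos.ne'
  rw [← Complex.exp_nat_mul]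
  congr 1
  field_simp

theorem IsNondegenerate.eval_pderiv_flow (hW : IsNondegenerate W w h) (t : ℝ)
    (p : Fin (m + 1) → ℂ) (k : Fin (m + 1)) :
    MvPolynomial.eval (flow w h t • p) (MvPolynomial.pderiv k W) * ((flow w h t k : ℂˣ) : ℂ)
      = Complex.exp (2 * Real.pi * Complex.I * t) *
        MvPolynomial.eval p (MvPolynomial.pderiv k W) := by
  have h1 := hW.eval_pderiv_scale k (Complex.exp (2 * Real.pi * Complex.I * t / h)) p
  rw [hW.exp_pow] at h1
  rw [← h1, flow_apply]
  congr 3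
  funext i
  rw [flow_smul_apply, flow_apply]

theorem IsNondegenerate.dW_flow (hW : IsNondegenerate W w h) (t : ℝ) (p v : Fin (m + 1) → ℂ) :
    dW W (flow w h t • p) (flow w h t • v) = Complex.exp (2 * Real.pi * Complex.I * t) * dW W p v := by
  simp only [dW, flow_smul_apply, ← mul_assoc, hW.eval_pderiv_flow, Finset.mul_sum]

theorem herm_flow (w : Fin (m + 1) → ℕ) (h : ℕ) (t : ℝ) {N : ℕ} (u v : Fin N → Fin (m + 1) → ℂ) :
    herm w (fun c => flow w h t • u c) (fun c => flow w h t • v c) = herm w u v := by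
  simp only [herm, flow_smul_apply, map_mul]
  refine Finset.sum_congr rfl fun c _ => Finset.sum_congr rfl fun k _ => ?_
  linear_combination (((Real.pi * (w k : ℝ))⁻¹ : ℝ) : ℂ) * conj (u c k) * v c k *
    conj_flow_mul_flow w h t k

theorem conj_herm (w : Fin (m + 1) → ℕ) {N : ℕ} (u v : Fin N → Fin (m + 1) → ℂ) :
    conj (herm w u v) = herm w v u := by
  simp only [herm, map_sum, map_mul, Complex.conj_ofReal, Complex.conj_conj]
  refine Finset.sum_congr rfl fun c _ => Finset.sum_congr rfl fun k _ => ?_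
  ring

theorem herm_sum_smul (w : Fin (m + 1) → ℕ) {N : ℕ} {ι : Type*} (s : Finset ι)
    (u : Fin N → Fin (m + 1) → ℂ) (x : ι → ℂ) (v : ι → Fin N → Fin (m + 1) → ℂ) :
    herm w u (∑ a ∈ s, x a • v a) = ∑ a ∈ s, x a * herm w u (v a) := by
  simp only [herm, Finset.sum_apply, Pi.smul_apply, smul_eq_mul, Finset.mul_sum]
  rw [Finset.sum_comm]
  refine Eq.symm ((Finset.sum_congr rfl fun a _ => Finset.sum_comm).trans ?_)
  rw [Finset.sum_comm]
  refine Finset.sum_congr rfl fun k _ => ?_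
  rw [Finset.sum_comm]
  refine Finset.sum_congr rfl fun c _ => Finset.sum_congr rfl fun a _ => ?_
  ring

theorem herm_sub (w : Fin (m + 1) → ℕ) {N : ℕ} (u v v' : Fin N → Fin (m + 1) → ℂ) :
    herm w u (v - v') = herm w u v - herm w u v' := by
  simp only [herm, Pi.sub_apply, mul_sub, Finset.sum_sub_distrib]

theorem dW_sum_smul (W : MvPolynomial (Fin (m + 1)) ℂ) (z : Fin (m + 1) → ℂ) {ι : Type*}
    (s : Finset ι) (x : ι → ℂ) (v : ι → Fin (m + 1) → ℂ) :
    dW W z (∑ a ∈ s, x a • v a) = ∑ a ∈ s, x a * dW W z (v a) := by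
  simp only [dW, Finset.sum_apply, Pi.smul_apply, smul_eq_mul, Finset.mul_sum]
  rw [Finset.sum_comm]
  refine Finset.sum_congr rfl fun a _ => Finset.sum_congr rfl fun i _ => ?_
  ring

theorem dW_sub (W : MvPolynomial (Fin (m + 1)) ℂ) (z v v' : Fin (m + 1) → ℂ) :
    dW W z (v - v') = dW W z v - dW W z v' := by
  simp only [dW, Pi.sub_apply, mul_sub, Finset.sum_sub_distrib]

theorem dW_normalVector {z : Fin (m + 1) → ℂ}
    (hz : ∃ i, MvPolynomial.eval z (MvPolynomial.pderiv i W) ≠ 0) :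
    dW W z (normalVector W z) = 1 := by
  obtain ⟨i, hi⟩ := hz
  obtain ⟨c, hc⟩ : ∃ c : Fin (m + 1) → ℂ,
      ∀ k, MvPolynomial.eval z (MvPolynomial.pderiv k W) = c k := ⟨_, fun _ => rfl⟩
  rw [hc] at hi
  have hpos : 0 < ∑ k, ‖c k‖ ^ 2 :=
    Finset.sum_pos' (fun k _ => sq_nonneg ‖c k‖) ⟨i, Finset.mem_univ i, pow_pos (norm_pos_iff.mpr hi) 2⟩
  simp only [dW, normalVector, hc, mul_div_assoc']
  rw [← Finset.sum_div, div_eq_one_iff_eq (by exact_mod_cast hpos.ne'), Complex.ofReal_sum]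
  refine Finset.sum_congr rfl fun k _ => ?_
  rw [Complex.mul_conj', Complex.ofReal_pow]

/-- The rows dual to the columns of `volumeForm`: the differentials `dW` of the `N` copies, and the
Hermitian products with the vectors of a frame. -/
def coframe (W : MvPolynomial (Fin (m + 1)) ℂ) (w : Fin (m + 1) → ℕ) {N : ℕ}
    (z : Fin (m + 1) → ℂ) (F : Fin N × Fin m → Fin N → Fin (m + 1) → ℂ) :
    Matrix (Fin N × Fin (m + 1)) (Fin N × Fin (m + 1)) ℂ :=
  Matrix.of fun r s =>
    (Fin.cases (if r.1 = s.1 then MvPolynomial.eval z (MvPolynomial.pderiv s.2 W) else 0)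
      (fun j => ((Real.pi * (w s.2 : ℝ))⁻¹ : ℝ) * conj (F (r.1, j) s.1 s.2)) r.2 : ℂ)

theorem coframe_mulVec_zero {N : ℕ} (z : Fin (m + 1) → ℂ)
    (F : Fin N × Fin m → Fin N → Fin (m + 1) → ℂ) (x : Fin N → Fin (m + 1) → ℂ) (a : Fin N) :
    (coframe W w z F *ᵥ fun s => x s.1 s.2) (a, 0) = dW W z (x a) := by
  simp only [Matrix.mulVec, dotProduct, coframe, Matrix.of_apply, Fin.cases_zero,
    Fintype.sum_prod_type, dW, ite_mul, zero_mul]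
  rw [Finset.sum_eq_single a]
  · simp
  · intro b _ hb
    simp [hb.symm]
  · simp

theorem coframe_mulVec_succ {N : ℕ} (z : Fin (m + 1) → ℂ)
    (F : Fin N × Fin m → Fin N → Fin (m + 1) → ℂ) (x : Fin N → Fin (m + 1) → ℂ) (a : Fin N)
    (i : Fin m) :
    (coframe W w z F *ᵥ fun s => x s.1 s.2) (a, i.succ) = herm w (F (a, i)) x := by
  simp only [Matrix.mulVec, dotProduct, coframe, Matrix.of_apply, Fin.cases_succ,
    Fintype.sum_prod_type, herm, mul_assoc]

/-- The first vectors of the `N` copies, followed by the other ones. -/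
def copiesEquiv (N m : ℕ) : Fin N ⊕ (Fin N × Fin m) ≃ Fin N × Fin (m + 1) where
  toFun := Sum.elim (fun a => (a, 0)) (fun a => (a.1, a.2.succ))
  invFun a := Fin.cases (Sum.inl a.1) (fun j => Sum.inr (a.1, j)) a.2
  left_inv := by rintro (a | a) <;> rfl
  right_inv := by
    rintro ⟨a, i⟩
    refine Fin.cases ?_ (fun j => ?_) i <;> rfl

/-- Normal vectors pair to the identity with `dW` and tangent vectors pair to zero, so the product
is block lower triangular with the Gram matrix as its other diagonal block. -/
theorem det_coframe_mul_volumeForm {N : ℕ} {z : Fin (m + 1) → ℂ}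
    (hz : ∃ i, MvPolynomial.eval z (MvPolynomial.pderiv i W) ≠ 0)
    (F G : Fin N × Fin m → Fin N → Fin (m + 1) → ℂ) (hG : ∀ a c, dW W z (G a c) = 0) :
    (coframe W w z F).det * volumeForm W z G
      = (Matrix.of fun a b => herm w (F a) (G b)).det := by
  rw [volumeForm, ← Matrix.det_mul]
  set V : Matrix (Fin N × Fin (m + 1)) (Fin N × Fin (m + 1)) ℂ :=
    Matrix.of fun (r s : Fin N × Fin (m + 1)) =>
      (Fin.cases (if r.1 = s.1 then normalVector W z r.2 else 0)
        (fun j => G (s.1, j) r.1 r.2) s.2 : ℂ) with hV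
  set y : Fin N → Fin N → Fin (m + 1) → ℂ := fun b c => if c = b then normalVector W z else 0
    with hy
  have hcol0 : ∀ b : Fin N, (fun r => V r (b, 0)) = fun r : Fin N × Fin (m + 1) =>
      y b r.1 r.2 := by
    intro b
    funext r
    simp only [hV, hy, Matrix.of_apply, Fin.cases_zero]
    split_ifs <;> rfl
  have hcol1 : ∀ (b : Fin N) (j : Fin m), (fun r => V r (b, j.succ)) =
      fun r : Fin N × Fin (m + 1) => G (b, j) r.1 r.2 := by
    intro b j
    funext r
    simp only [hV, Matrix.of_apply, Fin.cases_succ]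
  have hentry : ∀ r s, (coframe W w z F * V) r s = (coframe W w z F *ᵥ fun q => V q s) r := by
    intro r s; rfl
  rw [← Matrix.det_submatrix_equiv_self (copiesEquiv N m)]
  have hblock : (coframe W w z F * V).submatrix (copiesEquiv N m) (copiesEquiv N m)
      = Matrix.fromBlocks 1 0
          (Matrix.of fun a b => (coframe W w z F * V) (a.1, a.2.succ) (b, 0))
          (Matrix.of fun a b => herm w (F a) (G b)) := by
    ext r s
    rcases r with a | ⟨a, i⟩ <;> rcases s with b | ⟨b, j⟩
    · simp only [copiesEquiv, Equiv.coe_fn_mk, Matrix.submatrix_apply, Sum.elim_inl,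
        Matrix.fromBlocks_apply₁₁, hentry, hcol0]
      rw [coframe_mulVec_zero, Matrix.one_apply, hy]
      simp only
      split_ifs
      · exact dW_normalVector hz
      · simp [dW]
    · simp only [copiesEquiv, Equiv.coe_fn_mk, Matrix.submatrix_apply, Sum.elim_inl, Sum.elim_inr,
        Matrix.fromBlocks_apply₁₂, hentry, hcol1]
      rw [coframe_mulVec_zero, hG]
      rfl
    · rfl
    · simp only [copiesEquiv, Equiv.coe_fn_mk, Matrix.submatrix_apply, Sum.elim_inr,
        Matrix.fromBlocks_apply₂₂, hentry, hcol1, Matrix.of_apply]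
      rw [coframe_mulVec_succ]
  rw [hblock, Matrix.det_fromBlocks_zero₁₂, Matrix.det_one, one_mul]

theorem det_coframe_mul_volumeForm_self {N : ℕ} {z : Fin (m + 1) → ℂ}
    (hz : ∃ i, MvPolynomial.eval z (MvPolynomial.pderiv i W) ≠ 0)
    {F : Fin N × Fin m → Fin N → Fin (m + 1) → ℂ} (hF : ∀ a c, dW W z (F a c) = 0)
    (horth : ∀ a b, herm w (F a) (F b) = if a = b then 1 else 0) :
    (coframe W w z F).det * volumeForm W z F = 1 := by
  rw [det_coframe_mul_volumeForm hz F F hF]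
  have : (Matrix.of fun a b => herm w (F a) (F b)) = 1 := by
    ext a b
    rw [Matrix.of_apply, horth, Matrix.one_apply]
  rw [this, Matrix.det_one]

/-- A unitary frame expands tangent vectors. -/
theorem herm_eq_sum {N : ℕ} {z : Fin (m + 1) → ℂ}
    (hz : ∃ i, MvPolynomial.eval z (MvPolynomial.pderiv i W) ≠ 0)
    {F : Fin N × Fin m → Fin N → Fin (m + 1) → ℂ} (hF : ∀ a c, dW W z (F a c) = 0)
    (horth : ∀ a b, herm w (F a) (F b) = if a = b then 1 else 0)
    (u v : Fin N → Fin (m + 1) → ℂ) (hv : ∀ c, dW W z (v c) = 0) :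
    herm w u v = ∑ a, conj (herm w (F a) u) * herm w (F a) v := by
  have hdet : (coframe W w z F).det ≠ 0 :=
    left_ne_zero_of_mul_eq_one (det_coframe_mul_volumeForm_self hz hF horth)
  -- The difference is annihilated by every row of the invertible coframe.
  have hexp : v = ∑ a, herm w (F a) v • F a := by
    rw [← sub_eq_zero]
    set x := v - ∑ a, herm w (F a) v • F a with hx
    have h1 : (coframe W w z F *ᵥ fun s => x s.1 s.2) = 0 := by
      funext ⟨b, i⟩
      refine Fin.cases ?_ (fun j => ?_) i
      · rw [coframe_mulVec_zero, hx, Pi.sub_apply, Finset.sum_apply, dW_sub, hv]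
        simp only [Pi.smul_apply]
        rw [dW_sum_smul]
        simp [hF]
      · rw [coframe_mulVec_succ, hx, herm_sub, herm_sum_smul]
        simp [horth]
    have h2 := Matrix.eq_zero_of_mulVec_eq_zero hdet h1
    funext c k
    exact congrFun h2 (c, k)
  conv_lhs => rw [hexp]
  rw [herm_sum_smul]
  refine Finset.sum_congr rfl fun a _ => ?_
  rw [conj_herm, mul_comm]

/-- `Ω^{⊗N}` is multiplied by `exp (2πi N (∑ w_i / h - 1) t)` under the flow. -/
theorem volumeForm_flow (hW : IsNondegenerate W w h) {N : ℕ} {p : Fin (m + 1) → ℂ} (hp : p ≠ 0)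
    {F : Fin N × Fin m → Fin N → Fin (m + 1) → ℂ} (hF : ∀ a c, dW W p (F a c) = 0)
    (horth : ∀ a b, herm w (F a) (F b) = if a = b then 1 else 0) (t : ℝ) :
    volumeForm W (flow w h t • p) (fun a c => flow w h t • F a c)
      = Complex.exp (2 * Real.pi * Complex.I * (N * ((∑ i, (w i : ℂ)) / h - 1) * t)) *
        volumeForm W p F := by
  have hp' : flow w h t • p ≠ 0 := by
    intro h0
    exact hp ((smul_eq_zero_iff_eq _).mp h0)
  have h1 := det_coframe_mul_volumeForm_self (hW.exists_pderiv_ne_zero hp) hF horth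
  have h2 := det_coframe_mul_volumeForm_self (w := w) (hW.exists_pderiv_ne_zero hp')
    (F := fun a c => flow w h t • F a c)
    (fun a c => by rw [hW.dW_flow, hF, mul_zero]) (fun a b => by rw [herm_flow, horth])
  -- The `dW` rows acquire `exp (2πi t)`, the Hermitian rows are invariant, and the columns acquire
  -- the flow weights. Determinants give the factor of `Ω^{⊗N}`, the volume being inverse to the
  -- coframe determinant.
  have h3 : coframe W w (flow w h t • p) (fun a c => flow w h t • F a c) *
      Matrix.diagonal (fun s : Fin N × Fin (m + 1) => ((flow w h t s.2 : ℂˣ) : ℂ))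
      = Matrix.diagonal (fun r : Fin N × Fin (m + 1) =>
          (Fin.cases (Complex.exp (2 * Real.pi * Complex.I * t)) (fun _ => 1) r.2 : ℂ)) *
        coframe W w p F := by
    ext ⟨a, i⟩ ⟨b, k⟩
    rw [Matrix.mul_diagonal, Matrix.diagonal_mul]
    refine Fin.cases ?_ (fun j => ?_) i
    · simp only [coframe, Matrix.of_apply, Fin.cases_zero]
      split_ifs
      · exact hW.eval_pderiv_flow t p k
      · simp
    · simp only [coframe, Matrix.of_apply, Fin.cases_succ, flow_smul_apply, map_mul]
      linear_combination (((Real.pi * (w k : ℝ))⁻¹ : ℝ) : ℂ) * conj (F (a, j) b k) *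
        conj_flow_mul_flow w h t k
  have h4 := congrArg Matrix.det h3
  rw [Matrix.det_mul, Matrix.det_mul, Matrix.det_diagonal, Matrix.det_diagonal,
    Fintype.prod_prod_type, Fintype.prod_prod_type] at h4
  simp only [Fin.prod_univ_succ (n := m), Fin.cases_zero, Fin.cases_succ, Finset.prod_const_one,
    mul_one, Finset.prod_const, Finset.card_univ, Fintype.card_fin] at h4
  rw [← Fin.prod_univ_succ (fun i => ((flow w h t i : ℂˣ) : ℂ))] at h4
  have h5 : ∏ i, ((flow w h t i : ℂˣ) : ℂ)
      = Complex.exp (2 * Real.pi * Complex.I * ((∑ i, (w i : ℂ)) / h * t)) := by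
    simp only [flow, Units.val_mk0]
    rw [← Complex.exp_sum]
    congr 1
    rw [← Finset.sum_mul, ← Finset.mul_sum, Finset.sum_div]
    ring
  rw [h5, ← Complex.exp_nat_mul, ← Complex.exp_nat_mul] at h4
  set c' := (coframe W w (flow w h t • p) (fun a c => flow w h t • F a c)).det
  set c := (coframe W w p F).det
  have hc' : c' ≠ 0 := left_ne_zero_of_mul_eq_one h2
  refine mul_left_cancel₀ hc' (h2.trans ?_)
  have h6 : Complex.exp (2 * Real.pi * Complex.I * (N * ((∑ i, (w i : ℂ)) / h - 1) * t))
      * Complex.exp (N * (2 * Real.pi * Complex.I * t))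
      = Complex.exp (N * (2 * Real.pi * Complex.I * ((∑ i, (w i : ℂ)) / h * t))) := by
    rw [← Complex.exp_add]
    congr 1
    ring
  have h7 : Complex.exp ((N : ℂ) * (2 * Real.pi * Complex.I * t)) ≠ 0 := Complex.exp_ne_zero _
  refine mul_left_cancel₀ h7 ?_
  linear_combination (-Complex.exp ((N : ℂ) * (2 * Real.pi * Complex.I * t))) * h1 +
    volumeForm W p F * (-h4) - c' * volumeForm W p F * h6

end VolumeForm

/-! ### The index in an adapted frame -/

section AdaptedFrame

variable {m : ℕ} {W : MvPolynomial (Fin (m + 1)) ℂ} {w : Fin (m + 1) → ℕ} {h : ℕ}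

theorem flow_smul_ne_zero (w : Fin (m + 1) → ℕ) (h : ℕ) (t : ℝ) {p : Fin (m + 1) → ℂ}
    (hp : p ≠ 0) : flow w h t • p ≠ 0 := fun h0 => hp ((smul_eq_zero_iff_eq _).mp h0)

/-- `flowMatrix` expresses the transported frame in `F t`, so its determinant is the ratio of their
volumes. -/
theorem det_flowMatrix_mul_volumeForm (hW : IsNondegenerate W w h) {N : ℕ}
    {p : Fin (m + 1) → ℂ} (hp : p ≠ 0) {F : ℝ → Fin N × Fin m → Fin N → Fin (m + 1) → ℂ} {t : ℝ}
    (htan : ∀ a c, dW W (flow w h t • p) (F t a c) = 0)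
    (horth : ∀ a b, herm w (F t a) (F t b) = if a = b then 1 else 0)
    (htan0 : ∀ a c, dW W p (F 0 a c) = 0)
    (horth0 : ∀ a b, herm w (F 0 a) (F 0 b) = if a = b then 1 else 0) :
    (flowMatrix w h F t).det * volumeForm W (flow w h t • p) (F t)
      = Complex.exp (2 * Real.pi * Complex.I * (N * ((∑ i, (w i : ℂ)) / h - 1) * t)) *
        volumeForm W p (F 0) := by
  have hz := hW.exists_pderiv_ne_zero (flow_smul_ne_zero w h t hp)
  have h1 := det_coframe_mul_volumeForm_self hz htan horth
  have h2 := det_coframe_mul_volumeForm (w := w) hz (F t) (fun a c => flow w h t • F 0 a c)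
    (fun a c => by rw [hW.dW_flow, htan0, mul_zero])
  rw [← volumeForm_flow hW hp htan0 horth0 t]
  have h3 : (Matrix.of fun a b => herm w (F t a) (fun c => flow w h t • F 0 b c))
      = flowMatrix w h F t := rfl
  rw [h3] at h2
  rw [← h2]
  linear_combination (volumeForm W (flow w h t • p) fun a c => flow w h t • F 0 a c) * h1

/-- The flow is an isometry preserving `ker dW`; Parseval in the frame `F t` then gives unitarity.
-/
theorem flowMatrix_unitary (hW : IsNondegenerate W w h) {N : ℕ}
    {p : Fin (m + 1) → ℂ} (hp : p ≠ 0) {F : ℝ → Fin N × Fin m → Fin N → Fin (m + 1) → ℂ} {t : ℝ}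
    (htan : ∀ a c, dW W (flow w h t • p) (F t a c) = 0)
    (horth : ∀ a b, herm w (F t a) (F t b) = if a = b then 1 else 0)
    (htan0 : ∀ a c, dW W p (F 0 a c) = 0)
    (horth0 : ∀ a b, herm w (F 0 a) (F 0 b) = if a = b then 1 else 0) :
    (flowMatrix w h F t)ᴴ * flowMatrix w h F t = 1 := by
  have hz := hW.exists_pderiv_ne_zero (flow_smul_ne_zero w h t hp)
  ext a b
  have h1 := herm_eq_sum hz htan horth (fun c => flow w h t • F 0 a c)
    (fun c => flow w h t • F 0 b c) (fun c => by rw [hW.dW_flow, htan0, mul_zero])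
  rw [herm_flow, horth0] at h1
  rw [Matrix.one_apply, h1, Matrix.mul_apply]
  rfl

theorem flow_inv_smul_eq (hW : IsNondegenerate W w h) (v : Fin (m + 1) → ℂ) :
    (((monodromyElement hW)⁻¹ : diagonalSymmetry W) : Fin (m + 1) → ℂˣ) • (flow w h 1 • v) = v := by
  change (flow w h 1)⁻¹ • (flow w h 1 • v) = v
  rw [inv_smul_smul]

theorem robbinSalamon_flowPath (hW : IsNondegenerate W w h) {p : Fin (m + 1) → ℂ} (hp : p ≠ 0)
    {F : ℝ → Fin (Nat.card (diagonalSymmetry W)) × Fin m →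
      Fin (Nat.card (diagonalSymmetry W)) → Fin (m + 1) → ℂ}
    (hF : IsAdaptedFrame W w h (monodromyElement hW)⁻¹ 1 p F)
    (hreg : RegularCrossings (flowPath w h F) 1) :
    robbinSalamon (flowPath w h F) 1
      = 2 * (Nat.card (diagonalSymmetry W) * ((∑ i, (w i : ℝ)) / h - 1)) := by
  have hI0 : (0 : ℝ) ∈ Set.Icc (0 : ℝ) 1 := ⟨le_rfl, zero_le_one⟩
  have hI1 : (1 : ℝ) ∈ Set.Icc (0 : ℝ) 1 := ⟨zero_le_one, le_rfl⟩
  have htan0 : ∀ a c, dW W p (F 0 a c) = 0 := by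
    intro a c
    have := hF.tangent 0 hI0 a c
    rwa [flow_zero, one_smul] at this
  have horth0 := hF.orthonormal 0 hI0
  have htwist : ∀ a, F 1 a = fun c => flow w h 1 • F 0 a c := by
    intro a
    funext c
    rw [← hF.twist a c]
    change _ = flow w h 1 • ((flow w h 1)⁻¹ • F 1 a c)
    rw [smul_inv_smul]
  have hunit : ∀ t ∈ Set.Icc (0 : ℝ) 1, (flowMatrix w h F t)ᴴ * flowMatrix w h F t = 1 :=
    fun t ht => flowMatrix_unitary hW hp (hF.tangent t ht) (hF.orthonormal t ht) htan0 horth0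
  have hψ0 : flowMatrix w h F 0 = 1 := by
    ext a b
    simp only [flowMatrix, Matrix.of_apply, flow_zero, one_smul, Matrix.one_apply]
    exact horth0 a b
  have hψ1 : flowMatrix w h F 1 = 1 := by
    ext a b
    rw [flowMatrix, Matrix.of_apply, ← htwist, hF.orthonormal 1 hI1, Matrix.one_apply]
  have hderiv : ∀ t i j, HasDerivAt (fun s => flowMatrix w h F s i j)
      (deriv (fun s => flowMatrix w h F s i j) t) t := by
    intro t i j
    refine DifferentiableAt.hasDerivAt ?_
    have hd := hF.contDiff.differentiable one_ne_zero
    have hd' : ∀ c k, Differentiable ℝ (fun s => F s i c k) := by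
      intro c k
      exact differentiable_pi.mp (differentiable_pi.mp (differentiable_pi.mp hd i) c) k
    simp only [flowMatrix, Matrix.of_apply, herm, flow_smul_apply, flow, Units.val_mk0]
    refine DifferentiableAt.fun_sum fun c _ => DifferentiableAt.fun_sum fun k _ => ?_
    refine (differentiableAt_const _).mul ((hd' c k t).star.mul (DifferentiableAt.mul ?_
      (differentiableAt_const _)))
    exact (DifferentiableAt.const_mul Complex.ofRealCLM.differentiableAt _).cexp
  obtain ⟨L, hL, hexpL, hL01⟩ := hF.adapted
  set d : ℝ := Nat.card (diagonalSymmetry W) * ((∑ i, (w i : ℝ)) / h - 1) with hd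
  have hdet : ∀ t ∈ Set.Icc (0 : ℝ) 1, (flowMatrix w h F t).det
      = Complex.exp (2 * Real.pi * Complex.I * (d * t) + L 0 - L t) := by
    intro t ht
    have h1 := det_flowMatrix_mul_volumeForm hW hp (hF.tangent t ht) (hF.orthonormal t ht)
      htan0 horth0
    have h2 := hexpL 0 hI0
    rw [flow_zero, one_smul] at h2
    rw [← hexpL t ht, ← h2, ← Complex.exp_add] at h1
    rw [Complex.exp_sub, eq_div_iff (Complex.exp_ne_zero _), h1]
    congr 2
    rw [hd]
    push_cast
    ring
  have hnorm : ∀ t ∈ Set.Icc (0 : ℝ) 1, ‖(flowMatrix w h F t).det‖ = 1 := by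
    intro t ht
    have h1 := congrArg Matrix.det (hunit t ht)
    rw [Matrix.det_mul, Matrix.det_conjTranspose, Matrix.det_one, Complex.star_def,
      Complex.conj_mul'] at h1
    have h2 : ‖(flowMatrix w h F t).det‖ ^ 2 = 1 := by exact_mod_cast h1
    exact (pow_eq_one_iff_of_nonneg (norm_nonneg _) two_ne_zero).mp h2
  have key := robbinSalamon_loop (ψ := flowMatrix w h F)
    (ψ' := fun t => Matrix.of fun i j => deriv (fun s => flowMatrix w h F s i j) t)
    (θ := fun t => 2 * Real.pi * (d * t) + (L 0).im - (L t).im)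
    (fun t _ i j => hderiv t i j) hunit hψ0 hψ1 hreg
    (by
      refine ContinuousOn.sub (by fun_prop) ?_
      exact Complex.continuous_im.comp_continuousOn hL)
    -- Unitarity gives the determinant norm one, so the exponent in `hdet` is purely imaginary.
    (fun t ht => by
      have h1 := hnorm t ht
      rw [hdet t ht, Complex.norm_exp, Real.exp_eq_one_iff] at h1
      rw [hdet t ht]
      congr 1
      refine Complex.ext ?_ ?_
      · rw [h1]; simp
      · simp)
  have hpath : flowPath w h F = matrixPath (flowMatrix w h F) := rfl
  rw [hpath, key, hL01]
  have := Real.pi_ne_zero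
  field_simp
  ring

/-! ### Existence of adapted frames with regular crossings -/

/-- Rescaling coordinates by `√(π w_k)` turns the weighted metric into the standard one and `ker dW`
into an orthogonal complement. An orthonormal basis of it is repeated in each of the `N` summands.
-/
theorem exists_unitary_frame (hw : ∀ i, 0 < w i) {z : Fin (m + 1) → ℂ}
    (hz : ∃ i, MvPolynomial.eval z (MvPolynomial.pderiv i W) ≠ 0) (N : ℕ) :
    ∃ E : Fin N × Fin m → Fin N → Fin (m + 1) → ℂ, (∀ a c, dW W z (E a c) = 0) ∧
      ∀ a b, herm w (E a) (E b) = if a = b then 1 else 0 := by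
  obtain ⟨i, hi⟩ := hz
  have hpos : ∀ k, 0 < Real.pi * w k := fun k =>
    mul_pos Real.pi_pos (by exact_mod_cast hw k)
  set s : Fin (m + 1) → ℝ := fun k => Real.sqrt (Real.pi * w k) with hs
  have hs0 : ∀ k, s k ≠ 0 := fun k => (Real.sqrt_pos.mpr (hpos k)).ne'
  have hss : ∀ k, s k * s k = Real.pi * w k := fun k => Real.mul_self_sqrt (hpos k).le
  let v : EuclideanSpace ℂ (Fin (m + 1)) := WithLp.toLp 2
    (fun k => conj (MvPolynomial.eval z (MvPolynomial.pderiv k W) * s k))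
  have hv : v ≠ 0 := by
    intro h0
    have := congrArg (fun u : EuclideanSpace ℂ (Fin (m + 1)) => u i) h0
    simp [v, hs0, hi] at this
  have : Fact (Module.finrank ℂ (EuclideanSpace ℂ (Fin (m + 1))) = m + 1) := ⟨by simp⟩
  let b := OrthonormalBasis.fromOrthogonalSpanSingleton (𝕜 := ℂ) m hv
  let e : Fin m → Fin (m + 1) → ℂ := fun j k => s k * (b j : EuclideanSpace ℂ (Fin (m + 1))) k
  have he : ∀ j, dW W z (e j) = 0 := by
    intro j
    have h1 := Submodule.mem_orthogonal_singleton_iff_inner_right.mp (b j).2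
    rw [PiLp.inner_apply] at h1
    rw [← h1, dW]
    refine Finset.sum_congr rfl fun k _ => ?_
    simp [v, e]
    ring
  have horth : ∀ j j', ∑ k, (((Real.pi * (w k : ℝ))⁻¹ : ℝ) : ℂ) * (conj (e j k) * e j' k)
      = if j = j' then 1 else 0 := by
    intro j j'
    have h1 := orthonormal_iff_ite.mp b.orthonormal j j'
    rw [Submodule.coe_inner, PiLp.inner_apply] at h1
    rw [← h1]
    refine Finset.sum_congr rfl fun k _ => ?_
    have h2 : (((Real.pi * (w k : ℝ))⁻¹ : ℝ) : ℂ) * (s k * s k) = 1 := by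
      rw [← Complex.ofReal_mul, ← Complex.ofReal_mul, hss, inv_mul_cancel₀ (hpos k).ne',
        Complex.ofReal_one]
    simp only [e, map_mul, Complex.conj_ofReal, RCLike.inner_apply]
    linear_combination (conj ((b j : EuclideanSpace ℂ (Fin (m + 1))) k) *
      (b j' : EuclideanSpace ℂ (Fin (m + 1))) k) * h2
  refine ⟨fun a c => if c = a.1 then e a.2 else 0, ?_, ?_⟩
  · intro a c
    simp only
    split_ifs
    · exact he _
    · simp [dW]
  · rintro ⟨a, j⟩ ⟨b, j'⟩
    simp only [herm]
    rw [Finset.sum_eq_single a]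
    · by_cases hab : a = b
      · subst hab
        simpa using horth j j'
      · simp [hab]
    · intro c _ hc
      simp [hc]
    · simp

theorem exists_nonzero_int_sum {ι : Type*} [Fintype ι] (hι : 2 ≤ Fintype.card ι) (d : ℤ) :
    ∃ κ : ι → ℤ, (∀ i, κ i ≠ 0) ∧ ∑ i, κ i = d := by
  classical
  obtain ⟨x, y, hxy⟩ := Fintype.one_lt_card_iff.mp hι
  obtain ⟨α, β, hα, hβ, hαβ⟩ : ∃ α β : ℤ, α ≠ 0 ∧ β ≠ 0 ∧
      α + β = d - Fintype.card ι + 2 := by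
    -- All other entries are `1`; the pair `(1, 0)` being forbidden, a remaining sum `1` is split as
    -- `2 + (-1)`.
    by_cases h1 : d - Fintype.card ι + 2 = 1
    · exact ⟨2, -1, by norm_num, by norm_num, by rw [h1]; norm_num⟩
    · exact ⟨1, d - Fintype.card ι + 2 - 1, by norm_num, by omega, by ring⟩
  refine ⟨fun i => if i = x then α else if i = y then β else 1, fun i => ?_, ?_⟩
  · dsimp only
    split_ifs <;> simp [hα, hβ]
  · have h1 : ∀ i, (if i = x then α else if i = y then β else 1)
        = 1 + (if i = x then α - 1 else 0) + (if i = y then β - 1 else 0) := by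
      intro i
      by_cases hx : i = x
      · subst hx
        simp [hxy]
      · by_cases hy : i = y
        · subst hy
          simp [hxy.symm]
        · simp [hx, hy]
    simp only [h1, Finset.sum_add_distrib, Finset.sum_ite_eq', Finset.mem_univ, if_true]
    simp
    linarith

/-- Since `0 < w 0 < h`, the first entry of `J` is not `1`. Finiteness rules out the default
cardinality `0`. -/
theorem IsNondegenerate.two_le_card (hW : IsNondegenerate W w h) :
    2 ≤ Nat.card (diagonalSymmetry W) := by
  have := hW.finite_diagonalSymmetry
  rw [Nat.succ_le_iff, Finite.one_lt_card_iff_nontrivial]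
  refine ⟨monodromyElement hW, 1, fun h1 => ?_⟩
  have h2 : ((flow w h 1 0 : ℂˣ) : ℂ) = 1 := by
    have := congrFun (congrArg Subtype.val h1) 0
    exact congrArg Units.val this
  simp only [flow, Units.val_mk0, Complex.ofReal_one, mul_one] at h2
  obtain ⟨n, hn⟩ := Complex.exp_eq_one_iff.mp h2
  have hh : (h : ℂ) ≠ 0 := by exact_mod_cast hW.h_pos.ne'
  have h3 : (w 0 : ℂ) = n * h := by
    have h4 := Complex.two_pi_I_ne_zero
    rw [mul_comm] at hn
    have h5 := mul_right_cancel₀ h4 hn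
    rw [← h5]
    field_simp
  have h4 : (w 0 : ℤ) = n * h := by exact_mod_cast h3
  have h5 := hW.w_pos 0
  have h6 := hW.weight_lt 0
  have h7 : (0 : ℤ) < w 0 := by exact_mod_cast h5
  have h8 : (w 0 : ℤ) < h := by exact_mod_cast h6
  rcases le_or_gt n 0 with hn0 | hn0
  · nlinarith
  · nlinarith

/-- `J ^ N = 1` makes every `N w_i / h` an integer. -/
theorem IsNondegenerate.exists_int (hW : IsNondegenerate W w h) :
    ∃ d : ℤ, (d : ℂ) = Nat.card (diagonalSymmetry W) * ((∑ i, (w i : ℂ)) / h - 1) := by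
  have hfin := hW.finite_diagonalSymmetry
  have hh : (h : ℂ) ≠ 0 := by exact_mod_cast hW.h_pos.ne'
  have h1 : ∀ i, ∃ n : ℤ, (Nat.card (diagonalSymmetry W) : ℂ) * (w i / h) = n := by
    intro i
    have h2 : (monodromyElement hW) ^ Nat.card (diagonalSymmetry W) = 1 := pow_card_eq_one'
    have h3 : ((flow w h 1 i : ℂˣ) : ℂ) ^ Nat.card (diagonalSymmetry W) = 1 := by
      have h4 := congrFun (congrArg Subtype.val h2) i
      rw [Subgroup.coe_pow, Pi.pow_apply] at h4
      have h5 := congrArg Units.val h4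
      rw [Units.val_pow_eq_pow_val] at h5
      exact h5
    simp only [flow, Units.val_mk0, Complex.ofReal_one, mul_one] at h3
    rw [← Complex.exp_nat_mul] at h3
    obtain ⟨n, hn⟩ := Complex.exp_eq_one_iff.mp h3
    refine ⟨n, mul_right_cancel₀ Complex.two_pi_I_ne_zero ?_⟩
    rw [← hn]
    ring
  choose n hn using h1
  refine ⟨∑ i, n i - Nat.card (diagonalSymmetry W), ?_⟩
  push_cast
  simp only [← hn]
  rw [← Finset.mul_sum, ← Finset.sum_div]
  ring

/-- Take `F t = exp (-2πi κ_a t) R_t E_a` with nonzero integers `κ_a` of sum `N (∑ w_i / h - 1)`.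
The sum makes `Ω^{⊗N}(F_t)` constant; the flow becomes diagonal with entries `exp (2πi κ_a t)`, and
`κ_a ≠ 0` makes its crossings regular. At least two indices `a` are needed for such `κ` to exist in
general. -/
theorem exists_adaptedFrame (hm : 1 ≤ m) (hW : IsNondegenerate W w h) {p : Fin (m + 1) → ℂ}
    (hp : p ≠ 0) : ∃ F, IsAdaptedFrame W w h (monodromyElement hW)⁻¹ 1 p F ∧
      RegularCrossings (flowPath w h F) 1 := by
  obtain ⟨d, hd⟩ := hW.exists_int
  have hN2 := hW.two_le_card
  set N := Nat.card (diagonalSymmetry W) with hN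
  obtain ⟨κ, hκ0, hκ⟩ := exists_nonzero_int_sum (ι := Fin N × Fin m)
    (by simp only [Fintype.card_prod, Fintype.card_fin]; nlinarith) d
  obtain ⟨E, hE, hEo⟩ := exists_unitary_frame hW.w_pos (hW.exists_pderiv_ne_zero hp) N
  set x : ℝ → Fin N × Fin m → ℂ := fun t a => Complex.exp ((-(2 * Real.pi * κ a * t) : ℝ) * Complex.I)
    with hx
  have hx0 : ∀ a, x 0 a = 1 := by intro a; simp [hx]
  have hx1 : ∀ a, x 1 a = 1 := by
    intro a
    rw [hx]
    simp only
    rw [Complex.exp_eq_one_iff]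
    exact ⟨-κ a, by push_cast; ring⟩
  have hxx : ∀ t a, conj (x t a) * x t a = 1 := by
    intro t a
    rw [Complex.conj_mul', hx]
    simp only
    rw [Complex.norm_exp_ofReal_mul_I]
    simp
  set F : ℝ → Fin N × Fin m → Fin N → Fin (m + 1) → ℂ :=
    fun t a c k => x t a * (flow w h t • E a c) k with hF
  have hF0 : F 0 = E := by
    funext a c k
    simp [hF, hx0, flow_zero]
  have hdWF : ∀ t a c, dW W (flow w h t • p) (F t a c) = 0 := by
    intro t a c
    have h1 := hW.dW_flow t p (E a c)
    rw [hE, mul_zero] at h1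
    have h2 : dW W (flow w h t • p) (F t a c)
        = x t a * dW W (flow w h t • p) (flow w h t • E a c) := by
      simp only [dW, hF, Finset.mul_sum]
      refine Finset.sum_congr rfl fun k _ => ?_
      ring
    rw [h2, h1, mul_zero]
  have hherm : ∀ t a (u : Fin N → Fin (m + 1) → ℂ), herm w (F t a) (fun c => flow w h t • u c)
      = conj (x t a) * herm w (E a) u := by
    intro t a u
    rw [← herm_flow w h t (E a) u]
    simp only [herm, hF, Finset.mul_sum, map_mul]
    refine Finset.sum_congr rfl fun c _ => Finset.sum_congr rfl fun k _ => ?_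
    ring
  have horthF : ∀ t a b, herm w (F t a) (F t b) = if a = b then 1 else 0 := by
    intro t a b
    have h1 : herm w (F t a) (F t b)
        = x t b * herm w (F t a) (fun c => flow w h t • E b c) := by
      simp only [herm, Finset.mul_sum]
      refine Finset.sum_congr rfl fun c _ => Finset.sum_congr rfl fun k _ => ?_
      simp only [hF]
      ring
    rw [h1, hherm, hEo]
    split_ifs with hab
    · rw [hab, mul_one, mul_comm, hxx]
    · simp
  have hmat : flowMatrix w h F = fun t => Matrix.diagonal fun a => conj (x t a) := by
    funext t
    ext a b
    rw [flowMatrix, Matrix.of_apply, hherm, hF0, hEo, Matrix.diagonal_apply]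
    split_ifs <;> simp
  have hvol : ∀ t, volumeForm W (flow w h t • p) (F t) = volumeForm W p E := by
    intro t
    have h1 := det_flowMatrix_mul_volumeForm hW hp (hdWF t) (horthF t)
      (by rw [hF0]; exact hE) (by rw [hF0]; exact hEo)
    rw [hmat, hF0, ← hd] at h1
    simp only at h1
    have h2 : (Matrix.diagonal fun a => conj (x t a)).det
        = Complex.exp (2 * Real.pi * Complex.I * (d * t)) := by
      rw [Matrix.det_diagonal, ← hκ, Int.cast_sum, Finset.sum_mul, Finset.mul_sum, Complex.exp_sum]
      refine Finset.prod_congr rfl fun a _ => ?_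
      rw [hx]
      simp only
      rw [← Complex.exp_conj, map_mul, Complex.conj_ofReal, Complex.conj_I]
      congr 1
      push_cast
      ring
    rw [h2] at h1
    exact mul_left_cancel₀ (Complex.exp_ne_zero _) h1
  have hvol0 : volumeForm W p E ≠ 0 := right_ne_zero_of_mul_eq_one
    (det_coframe_mul_volumeForm_self (hW.exists_pderiv_ne_zero hp) hE hEo)
  refine ⟨F, ⟨?_, fun t _ => hdWF t, fun t _ => horthF t, ?_, ?_⟩, ?_⟩
  · refine contDiff_pi.mpr fun a => contDiff_pi.mpr fun c => contDiff_pi.mpr fun k => ?_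
    simp only [hF, hx, flow_smul_apply, flow, Units.val_mk0]
    have h1 : ContDiff ℝ 1 (fun t : ℝ => (t : ℂ)) := Complex.ofRealCLM.contDiff
    refine ContDiff.mul (ContDiff.cexp ?_) (ContDiff.mul (ContDiff.cexp ?_) contDiff_const)
    · push_cast
      exact ((contDiff_const.mul h1).neg).mul contDiff_const
    · exact contDiff_const.mul h1
  · intro a c
    rw [hF0]
    have h1 : F 1 a c = flow w h 1 • E a c := by
      funext k
      simp [hF, hx1]
    rw [h1, flow_inv_smul_eq]
  · exact ⟨fun _ => Complex.log (volumeForm W p E), continuousOn_const, fun t _ => by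
      rw [hvol, Complex.exp_log hvol0], rfl⟩
  · intro t _
    have hpath : flowPath w h F = matrixPath (flowMatrix w h F) := rfl
    rw [hpath, hmat]
    set D : Matrix (Fin N × Fin m) (Fin N × Fin m) ℂ :=
      Matrix.diagonal fun a => (2 * Real.pi * κ a : ℝ) * Complex.I * conj (x t a) with hD
    have hder : ∀ i j, HasDerivAt
        (fun s => (Matrix.diagonal fun a => conj (x s a) : Matrix (Fin N × Fin m) _ ℂ) i j)
        (D i j) t := by
      intro i j
      by_cases hij : i = j
      · subst hij
        simp only [hD, Matrix.diagonal_apply_eq]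
        have h1 : ∀ s, conj (x s i) = Complex.exp ((2 * Real.pi * κ i : ℝ) * Complex.I * s) := by
          intro s
          rw [hx]
          simp only
          rw [← Complex.exp_conj, map_mul, Complex.conj_ofReal, Complex.conj_I]
          congr 1
          push_cast
          ring
        simp only [h1]
        have h2 : HasDerivAt (fun s : ℝ => ((2 * Real.pi * κ i : ℝ) : ℂ) * Complex.I * (s : ℂ))
            (((2 * Real.pi * κ i : ℝ) : ℂ) * Complex.I) t := by
          simpa using (Complex.ofRealCLM.hasDerivAt (x := t)).const_mul
            (((2 * Real.pi * κ i : ℝ) : ℂ) * Complex.I)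
        have h3 := h2.cexp
        rwa [mul_comm (Complex.exp _)] at h3
      · simp only [hD, Matrix.diagonal_apply_ne _ hij]
        exact hasDerivAt_const t 0
    set ψ : ℝ → Matrix (Fin N × Fin m) (Fin N × Fin m) ℂ :=
      fun t => Matrix.diagonal fun a => conj (x t a) with hψ
    have hfix : ∀ v : Fin N × Fin m → ℂ, v ∈ crossingSpace (matrixPath ψ) t ↔
        ∀ a, conj (x t a) * v a = v a := by
      intro v
      rw [mem_crossingSpace, funext_iff]
      simp only [hψ, Matrix.mulVec_diagonal]
    have hQ : ∀ v : crossingSpace (matrixPath ψ) t, crossingForm (matrixPath ψ) t v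
        = ∑ a, 2 * Real.pi * κ a * (((v : Fin N × Fin m → ℂ) a).re ^ 2 +
          ((v : Fin N × Fin m → ℂ) a).im ^ 2) := by
      intro v
      rw [crossingForm_matrixPath hder, dotProduct, Complex.im_sum]
      refine Finset.sum_congr rfl fun a _ => ?_
      have h1 := (hfix v).mp v.2 a
      rw [hD, Matrix.mulVec_diagonal, mul_assoc, h1]
      simp
      ring
    intro v hv
    -- Testing against `κ v` replaces the indefinite coefficients `κ_a` by `κ_a ^ 2`, so the pairing
    -- is definite.
    have hy : (fun a => (κ a : ℂ) * (v : Fin N × Fin m → ℂ) a) ∈ crossingSpace (matrixPath ψ) t := by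
      rw [hfix]
      intro a
      rw [mul_left_comm, (hfix v).mp v.2 a]
    have h1 := hv ⟨_, hy⟩
    rw [QuadraticMap.polarBilin_apply_apply, QuadraticMap.polar, hQ, hQ, hQ,
      ← Finset.sum_sub_distrib, ← Finset.sum_sub_distrib] at h1
    have h2 : ∑ a, 4 * Real.pi * (κ a : ℝ) ^ 2 * (((v : Fin N × Fin m → ℂ) a).re ^ 2 +
          ((v : Fin N × Fin m → ℂ) a).im ^ 2) = 0 := by
      rw [← h1]
      refine Finset.sum_congr rfl fun a _ => ?_
      simp
      ring
    rw [Finset.sum_eq_zero_iff_of_nonneg (fun a _ => by have := Real.pi_pos; positivity)] at h2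
    refine Subtype.ext (funext fun a => ?_)
    have h3 := h2 a (Finset.mem_univ a)
    have h4 : (κ a : ℝ) ≠ 0 := by exact_mod_cast hκ0 a
    have h5 : 4 * Real.pi * (κ a : ℝ) ^ 2 ≠ 0 := by
      have := Real.pi_ne_zero
      positivity
    have h6 := (mul_eq_zero.mp h3).resolve_left h5
    refine Complex.ext ?_ ?_
    · simp only [ZeroMemClass.coe_zero, Pi.zero_apply, Complex.zero_re]
      nlinarith [sq_nonneg ((v : Fin N × Fin m → ℂ) a).re, sq_nonneg ((v : Fin N × Fin m → ℂ) a).im]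
    · simp only [ZeroMemClass.coe_zero, Pi.zero_apply, Complex.zero_im]
      nlinarith [sq_nonneg ((v : Fin N × Fin m → ℂ) a).re, sq_nonneg ((v : Fin N × Fin m → ℂ) a).im]

end AdaptedFrame

/-! ### The space of principal orbits -/

section PrincipalOrbits

variable {m : ℕ} {W : MvPolynomial (Fin (m + 1)) ℂ} {w : Fin (m + 1) → ℕ} {h : ℕ}

theorem twistedOrbits_principal (hW : IsNondegenerate W w h) (δ : ℝ) :
    twistedOrbits W w h δ (monodromyElement hW)⁻¹ 1 = link W δ :=
  Set.ext fun p => and_iff_left (flow_inv_smul_eq hW p)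

theorem indexValues_principal (hm : 1 ≤ m) (hW : IsNondegenerate W w h) {δ : ℝ} (hδ : 0 < δ) :
    indexValues W w h δ (monodromyElement hW)⁻¹ 1 = {2 * ((∑ i, (w i : ℝ)) - h) / h} := by
  have hN : (Nat.card (diagonalSymmetry W) : ℝ) ≠ 0 := by
    have := hW.two_le_card
    exact_mod_cast (by omega : Nat.card (diagonalSymmetry W) ≠ 0)
  have hh : (h : ℝ) ≠ 0 := by exact_mod_cast hW.h_pos.ne'
  have hval : 2 * (Nat.card (diagonalSymmetry W) * ((∑ i, (w i : ℝ)) / h - 1)) /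
      (Nat.card (diagonalSymmetry W) : ℝ) = 2 * ((∑ i, (w i : ℝ)) - h) / h := by
    field_simp
  refine Set.eq_singleton_iff_unique_mem.mpr ⟨?_, ?_⟩
  · obtain ⟨p, hp⟩ := hW.link_nonempty hm hδ
    have hp0 := ne_zero_of_mem_link hδ hp
    obtain ⟨F, hF, hreg⟩ := exists_adaptedFrame hm hW hp0
    refine ⟨p, (twistedOrbits_principal hW δ).symm ▸ hp, F, hF, hreg, ?_⟩
    rw [robbinSalamon_flowPath hW hp0 hF hreg, hval]
  · rintro μ ⟨p, hp, F, hF, hreg, rfl⟩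
    rw [twistedOrbits_principal] at hp
    rw [robbinSalamon_flowPath hW (ne_zero_of_mem_link hδ hp) hF hreg, hval]

theorem componentIndex_principal (hm : 1 ≤ m) (hW : IsNondegenerate W w h) {δ : ℝ} (hδ : 0 < δ) :
    componentIndex W w h δ (monodromyElement hW)⁻¹ 1 = 2 * ((∑ i, (w i : ℝ)) - h) / h := by
  have h1 : indexValues W w h δ (monodromyElement hW)⁻¹ 1
      = {componentIndex W w h δ (monodromyElement hW)⁻¹ 1} :=
    Classical.epsilon_spec (p := fun μ : ℝ => indexValues W w h δ (monodromyElement hW)⁻¹ 1 = {μ})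
      ⟨_, indexValues_principal hm hW hδ⟩
  rw [indexValues_principal hm hW hδ] at h1
  exact (Set.singleton_injective h1).symm

/-! ### Dimension of the link and degree shift. -/

/-- The equations of the tangent space of the link at `p`. -/
def linkEquations (W : MvPolynomial (Fin (m + 1)) ℂ) (p : Fin (m + 1) → ℂ) :
    (Fin (m + 1) → ℂ) →ₗ[ℝ] ℂ × ℝ where
  toFun v := (dW W p v, (∑ i, conj (p i) * v i).re)
  map_add' u v := by
    simp only [dW, Pi.add_apply, mul_add, Finset.sum_add_distrib, Complex.add_re, Prod.mk_add_mk]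
  map_smul' c v := by
    have h1 : ∀ x : ℂ, ∀ i, x * (c • v) i = c • (x * v i) := fun x i => by
      rw [Pi.smul_apply, mul_smul_comm]
    simp only [dW, h1, ← Finset.smul_sum, Complex.smul_re, Prod.smul_mk, RingHom.id_apply]

theorem IsNondegenerate.dW_euler (hW : IsNondegenerate W w h) (p : Fin (m + 1) → ℂ) :
    dW W p (fun i => w i * p i) = h * MvPolynomial.eval p W := by
  have h1 := congrArg (MvPolynomial.eval p) hW.homogeneous.sum_weight_X_mul_pderiv
  simp only [map_sum, map_mul, MvPolynomial.eval_X, nsmul_eq_mul, map_natCast] at h1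
  rw [← h1, dW]
  exact Finset.sum_congr rfl fun i _ => by ring

/-- The normal vector reaches the `ℂ` factor. The Euler vector `(w_i p_i)` is tangent to `W⁻¹(0)`
and has positive radial part, so it adjusts the `ℝ` factor independently. -/
theorem linkEquations_surjective (hW : IsNondegenerate W w h) {p : Fin (m + 1) → ℂ} (hp : p ≠ 0)
    (hp0 : MvPolynomial.eval p W = 0) : Function.Surjective (linkEquations W p) := by
  set e : Fin (m + 1) → ℂ := fun i => w i * p i with he
  have hde : dW W p e = 0 := by rw [he, hW.dW_euler, hp0, mul_zero]
  have hre : (∑ i, conj (p i) * e i).re ≠ 0 := by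
    have h1 : ∑ i, conj (p i) * e i = ((∑ i, (w i : ℝ) * ‖p i‖ ^ 2 : ℝ) : ℂ) := by
      rw [Complex.ofReal_sum]
      refine Finset.sum_congr rfl fun i _ => ?_
      rw [he, Complex.ofReal_mul, Complex.ofReal_pow, ← Complex.conj_mul']
      push_cast
      ring
    rw [h1, Complex.ofReal_re]
    obtain ⟨i, hi⟩ := Function.ne_iff.mp hp
    refine (Finset.sum_pos' (fun k _ => by positivity) ⟨i, Finset.mem_univ i, ?_⟩).ne'
    have h2 : (0 : ℝ) < w i := by exact_mod_cast hW.w_pos i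
    exact mul_pos h2 (pow_pos (norm_pos_iff.mpr hi) 2)
  have hLe : linkEquations W p e = (0, (∑ i, conj (p i) * e i).re) := by
    rw [← hde]
    rfl
  rintro ⟨a, b⟩
  set u : Fin (m + 1) → ℂ := fun i => a * normalVector W p i with hu
  have hdu : dW W p u = a := by
    have h1 : dW W p u = a * dW W p (normalVector W p) := by
      simp only [dW, hu, Finset.mul_sum]
      exact Finset.sum_congr rfl fun i _ => by ring
    rw [h1, dW_normalVector (hW.exists_pderiv_ne_zero hp), mul_one]
  have hLu : linkEquations W p u = (a, (∑ i, conj (p i) * u i).re) := by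
    exact Prod.ext hdu rfl
  refine ⟨u + ((b - (∑ i, conj (p i) * u i).re) / (∑ i, conj (p i) * e i).re) • e, ?_⟩
  rw [map_add, map_smul, hLe, hLu]
  rw [Prod.smul_mk, smul_zero, smul_eq_mul, div_mul_cancel₀ _ hre, Prod.mk_add_mk, add_zero,
    add_sub_cancel]

theorem tangentSpace_principal (hW : IsNondegenerate W w h) (p : Fin (m + 1) → ℂ) :
    tangentSpace W w h (monodromyElement hW)⁻¹ 1 p = LinearMap.ker (linkEquations W p) := by
  ext v
  rw [LinearMap.mem_ker]
  exact (and_iff_right (flow_inv_smul_eq hW v)).trans Prod.mk_eq_zero.symm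

theorem finrank_tangentSpace_principal (hW : IsNondegenerate W w h) {p : Fin (m + 1) → ℂ}
    (hp : p ≠ 0) (hp0 : MvPolynomial.eval p W = 0) :
    Module.finrank ℝ (tangentSpace W w h (monodromyElement hW)⁻¹ 1 p) = 2 * m - 1 := by
  have h1 := (linkEquations W p).finrank_range_add_finrank_ker
  rw [LinearMap.range_eq_top.mpr (linkEquations_surjective hW hp hp0), finrank_top,
    Module.finrank_prod, Complex.finrank_real_complex, Module.finrank_self,
    Module.finrank_pi_fintype] at h1
  simp only [Complex.finrank_real_complex, Finset.sum_const, Finset.card_univ, Fintype.card_fin,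
    smul_eq_mul] at h1
  rw [tangentSpace_principal]
  omega

theorem orbitsDim_principal (hm : 1 ≤ m) (hW : IsNondegenerate W w h) {δ : ℝ} (hδ : 0 < δ) :
    orbitsDim W w h δ (monodromyElement hW)⁻¹ 1 = 2 * m - 1 := by
  have h1 : {d | ∃ p ∈ twistedOrbits W w h δ (monodromyElement hW)⁻¹ 1,
      d = Module.finrank ℝ (tangentSpace W w h (monodromyElement hW)⁻¹ 1 p)} = {2 * m - 1} := by
    rw [twistedOrbits_principal]
    refine Set.eq_singleton_iff_unique_mem.mpr ⟨?_, ?_⟩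
    · obtain ⟨p, hp⟩ := hW.link_nonempty hm hδ
      exact ⟨p, hp, (finrank_tangentSpace_principal hW (ne_zero_of_mem_link hδ hp) hp.1).symm⟩
    · rintro d ⟨p, hp, rfl⟩
      exact finrank_tangentSpace_principal hW (ne_zero_of_mem_link hδ hp) hp.1
  rw [orbitsDim, h1, csSup_singleton]

/-- With dimension `2m - 1` the terms `m` and `(2m - 1 + 1) / 2` cancel. -/
theorem degreeShift_principal (hm : 1 ≤ m) (hW : IsNondegenerate W w h) {δ : ℝ} (hδ : 0 < δ) :
    degreeShift W w h δ (monodromyElement hW)⁻¹ 1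
      = -componentIndex W w h δ (monodromyElement hW)⁻¹ 1 := by
  rw [degreeShift, orbitsDim_principal hm hW hδ, Nat.cast_sub (by omega)]
  push_cast
  ring

end PrincipalOrbits

end MonodromyOrbit

end

/-! ### The index and degree of the monodromy orbit. -/

theorem mainTheorem7 {m : ℕ} (hm : 1 ≤ m) (W : MvPolynomial (Fin (m + 1)) ℂ)
    (w : Fin (m + 1) → ℕ) (h : ℕ) (hW : MonodromyOrbit.IsNondegenerate W w h)
    (δ : ℝ) (hδ : 0 < δ) :
    (MonodromyOrbit.monodromyOrbit hW δ).indexValues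
        = {(MonodromyOrbit.monodromyOrbit hW δ).muRS} ∧
    (MonodromyOrbit.monodromyOrbit hW δ).deg = -(MonodromyOrbit.monodromyOrbit hW δ).muRS ∧
    -(MonodromyOrbit.monodromyOrbit hW δ).muRS
        = -(2 * ((∑ i, (w i : ℝ)) - (h : ℝ)) / (h : ℝ)) ∧
    (0 ≤ (∑ i, (w i : ℤ)) - (h : ℤ) ↔ 0 ≤ (MonodromyOrbit.monodromyOrbit hW δ).muRS) := by
  have hmu : (MonodromyOrbit.monodromyOrbit hW δ).muRS
      = 2 * ((∑ i, (w i : ℝ)) - (h : ℝ)) / (h : ℝ) :=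
    MonodromyOrbit.componentIndex_principal hm hW hδ
  refine ⟨?_, ?_, by rw [hmu], ?_⟩
  · rw [hmu]
    exact MonodromyOrbit.indexValues_principal hm hW hδ
  -- The fundamental class is a `0`-cochain, so its degree is the shift alone.
  · change ((0 : ℕ) : ℝ) + MonodromyOrbit.degreeShift W w h δ
      (MonodromyOrbit.monodromyElement hW)⁻¹ 1 = _
    rw [MonodromyOrbit.degreeShift_principal hm hW hδ, Nat.cast_zero, zero_add]
    rfl
  · have hh : (0 : ℝ) < h := by exact_mod_cast hW.h_pos
    have hcast : (∑ i, (w i : ℝ)) - (h : ℝ) = (((∑ i, (w i : ℤ)) - (h : ℤ) : ℤ) : ℝ) := by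
      push_cast
      rfl
    rw [hmu, le_div_iff₀ hh, zero_mul, mul_nonneg_iff_of_pos_left two_pos, hcast, Int.cast_nonneg_iff]
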